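/- Let $G$ be a connected triangle-free plane graph with $n\ge 3$ vertices, that is, a finite simple graph drawn in the plane with vertices represented by distinct points, edges by simple arcs joining their ends, no edge passing through a vertex other than its ends, and distinct edges meeting only in common ends. A face of $G$ (the unbounded one included) is a connected component of the complement of the drawing; its length is the number of edges on its boundary, with bridges counted twice. For $i\ge 4$ let $s_i$ be the number of faces of $G$ of length exactly $i$, and let $s^+=\sum_{i\ge 5}(i-4)s_i$. Let $\varphi$ be a proper $3$-coloring of $G$, and let $q$ be the number of faces of length $4$ that are bichromatic, that is, for which the set of colors assigned by $\varphi$ to the vertices incident with the face has size exactly two. Then $G$ has at least $2^{(s^++8+q)/6}$ distinct proper $3$-colorings. -/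

import Mathlib

open Set

/-- A plane graph: a drawing of the simple graph `G` in the Euclidean plane (here `ℂ`). Vertices are
distinct points, every edge is a simple arc joining its two ends, an edge passes through
no vertex other than its ends, and two different edges meet in vertices only. -/
structure PlaneDrawing {V : Type*} (G : SimpleGraph V) where
  /-- the position of a vertex -/
  point : V → ℂ
  point_injective : Function.Injective point
  /-- the arc (as a point set, ends included) that represents an edge -/
  arc : G.edgeSet → Set ℂ
  arc_isArc : ∀ (u v : V) (h : G.Adj u v),
    ∃ γ : Path (point u) (point v), Function.Injective γ ∧ range γ = arc ⟨s(u, v), h⟩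
  mem_of_point_mem_arc : ∀ (e : G.edgeSet) (v : V), point v ∈ arc e → v ∈ (e : Sym2 V)
  arc_inter_arc : ∀ e e' : G.edgeSet, e ≠ e' → arc e ∩ arc e' ⊆ range point

namespace PlaneDrawing

variable {V : Type*} {G : SimpleGraph V} (D : PlaneDrawing G)

/-- The point set of the drawing: all vertices and all edges. -/
def support : Set ℂ := range D.point ∪ ⋃ e, D.arc e

/-- The faces (the unbounded one included): the connected components of the complement of the
drawing. -/
def faces : Set (Set ℂ) :=
  {F | ∃ z ∈ D.supportᶜ, F = connectedComponentIn D.supportᶜ z}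

/-- The vertex `v` is incident with the face `F`. -/
def VertexIncident (v : V) (F : Set ℂ) : Prop := D.point v ∈ frontier F

/-- The edge `e` is incident with the face `F`. -/
def EdgeIncident (e : G.edgeSet) (F : Set ℂ) : Prop := D.arc e ⊆ frontier F

/-- The length of a face: the number of edges incident with it, bridges (cut edges) being counted
twice. In a connected plane graph this is the length of the boundary walk of the face. -/
noncomputable def faceLength (F : Set ℂ) : ℕ :=
  {e : G.edgeSet | D.EdgeIncident e F}.ncard +
    {e : G.edgeSet | D.EdgeIncident e F ∧ G.IsBridge (e : Sym2 V)}.ncard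

/-- `s_i`, the number of faces of length exactly `i`. -/
noncomputable def numFaces (i : ℕ) : ℕ := {F ∈ D.faces | D.faceLength F = i}.ncard

/-- `s⁺ = ∑_{i ≥ 5} (i - 4) s_i`. Only finitely many terms are nonzero, since a face has length
at most twice the number of edges. -/
noncomputable def sPlus : ℕ := ∑ᶠ (i : ℕ) (_ : 5 ≤ i), (i - 4) * D.numFaces i

/-- A face is bichromatic if exactly two colors occur on the vertices incident with it. -/
def Bichromatic (φ : G.Coloring (Fin 3)) (F : Set ℂ) : Prop :=
  (φ '' {v | D.VertexIncident v F}).ncard = 2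

/-- The number of bichromatic faces of length `4`. -/
noncomputable def numBichromatic (φ : G.Coloring (Fin 3)) : ℕ :=
  {F ∈ D.faces | D.faceLength F = 4 ∧ D.Bichromatic φ F}.ncard

end PlaneDrawing

/-! Fix a color `k` and let `G_k` be the spanning subgraph of the edges avoiding `k`, with `c_k`
components and `f_k` faces; let `n_k` be the number of vertices of color `k`. These vertices are
isolated in `G_k`, and on each of the other `c_k - n_k` components the two remaining colors can be
interchanged independently. Hence the number `N` of colorings is at least `2 ^ (c_k - n_k)`
(`two_pow_card_connectedComponent_le`). Multiplying over the three colors gives `N ^ 3 ≥ 2 ^ (c_0 +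
c_1 + c_2 - n)`.

Every edge lies in exactly one `G_k`, so Euler's formula for the three subgraphs gives `∑ c_k - n =
2n - e + ∑ (f_k - 1)`. Since `G` is connected and all faces have length at least 4, Euler's formula
for `G` gives `2 (2n - e) = s⁺ + 8` (`sPlus_add_eight`). It remains to see that `q ≤ 2 ∑ (f_k - 1)`.
A bichromatic 4-face without color `k` is still a face of `G_k`, so there are at most `f_k` of them,
and `f_k ≤ 2 (f_k - 1)` once `f_k ≥ 2`. If `f_k = 1` and there is such a face, then `G = G_k` is a
tree whose only face has length 4; this case is settled by the Kempe changes for the other two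
colors.

Faces are topological components here, so Euler's formula and the incidence of edges with faces are
proved from scratch. The tool is Eilenberg's criterion: two points off a compact set `K` lie in one
component of the complement if `(z - a) / (z - b)` has a continuous logarithm on `K`. Attaching an
arc to `K` then becomes a question of gluing logarithms at its two ends. The arc leaves its face in
one piece if its ends lie in separated compact parts of `K`. It cuts the face in exactly two if they
are joined in `K`, and both pieces then have the whole arc on their boundary. -/

open Set

/-! ### Continuous logarithms and winding numbers -/

/-- The function `f` has a continuous logarithm on the set `S`. -/
def HasLogOn {X : Type*} [TopologicalSpace X] (f : X → ℂ) (S : Set X) : Prop :=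
  ∃ g : X → ℂ, ContinuousOn g S ∧ ∀ z ∈ S, Complex.exp (g z) = f z

namespace HasLogOn

variable {X : Type*} [TopologicalSpace X] {f f' : X → ℂ} {S T : Set X}

lemma mono (h : HasLogOn f S) (hT : T ⊆ S) : HasLogOn f T := by
  obtain ⟨g, hg, he⟩ := h
  exact ⟨g, hg.mono hT, fun z hz => he z (hT hz)⟩

lemma congr (h : HasLogOn f S) (hf : ∀ z ∈ S, f z = f' z) : HasLogOn f' S := by
  obtain ⟨g, hg, he⟩ := h
  exact ⟨g, hg, fun z hz => (he z hz).trans (hf z hz)⟩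

lemma const {c : ℂ} (hc : c ≠ 0) : HasLogOn (fun _ : X => c) S :=
  ⟨fun _ => Complex.log c, continuousOn_const, fun _ _ => Complex.exp_log hc⟩

lemma mul (h : HasLogOn f S) (h' : HasLogOn f' S) : HasLogOn (fun z => f z * f' z) S := by
  obtain ⟨g, hg, he⟩ := h
  obtain ⟨g', hg', he'⟩ := h'
  exact ⟨fun z => g z + g' z, hg.add hg', fun z hz => by rw [Complex.exp_add, he z hz, he' z hz]⟩

lemma zpow (h : HasLogOn f S) (n : ℤ) : HasLogOn (fun z => f z ^ n) S := by
  obtain ⟨g, hg, he⟩ := h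
  exact ⟨fun z => n * g z, continuousOn_const.mul hg,
    fun z hz => by rw [Complex.exp_int_mul, he z hz]⟩

/-- Homotopy lifting for the exponential covering. -/
lemma of_homotopy {h : unitInterval → X → ℂ}
    (hc : ContinuousOn (fun p : unitInterval × X => h p.1 p.2) (univ ×ˢ S))
    (h0 : ∀ t, ∀ z ∈ S, h t z ≠ 0) (H : HasLogOn (h 0) S) : HasLogOn (h 1) S := by
  classical
  obtain ⟨g, hg, he⟩ := H
  have hc' : Continuous (fun p : unitInterval × S => h p.1 p.2) := by
    refine hc.comp_continuous (f := fun p : unitInterval × S => (p.1, (p.2 : X))) (by fun_prop) ?_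
    intro p
    exact ⟨trivial, p.2.2⟩
  let F : C(unitInterval × S, {z : ℂ // z ≠ 0}) :=
    ⟨fun p => ⟨h p.1 p.2, h0 _ _ p.2.2⟩, hc'.subtype_mk _⟩
  let g' : C(S, ℂ) := ⟨S.domRestrict g, continuousOn_iff_continuous_domRestrict.mp hg⟩
  have H0 : ∀ a, F (0, a) = (⟨_, Complex.exp_ne_zero (g' a)⟩ : {z : ℂ // z ≠ 0}) := by
    intro a
    exact Subtype.ext (he a a.2).symm
  have hl := Complex.isCoveringMap_exp.liftHomotopy_lifts F g' H0
  set L := Complex.isCoveringMap_exp.liftHomotopy F g' H0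
  refine ⟨fun z => if hz : z ∈ S then L (1, ⟨z, hz⟩) else 0, ?_, ?_⟩
  · rw [continuousOn_iff_continuous_domRestrict]
    have : S.domRestrict (fun z => if hz : z ∈ S then L (1, ⟨z, hz⟩) else 0) =
        fun z : S => L (1, z) := by
      ext z; simp [Set.domRestrict]
    rw [this]
    fun_prop
  · intro z hz
    have := congr_arg Subtype.val (congr_fun hl (1, ⟨z, hz⟩))
    simpa [hz, F] using this

end HasLogOn

/-- Two continuous logarithms of the same function on a preconnected set differ by a constant. -/
lemma exists_eqOn_add_of_exp_eq {X : Type*} [TopologicalSpace X] {S : Set X}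
    (hS : IsPreconnected S) {g g' : X → ℂ}
    (hg : ContinuousOn g S) (hg' : ContinuousOn g' S)
    (he : ∀ z ∈ S, Complex.exp (g z) = Complex.exp (g' z)) :
    ∃ c, Complex.exp c = 1 ∧ ∀ z ∈ S, g z = g' z + c := by
  let Z : AddSubgroup ℂ := AddSubgroup.zmultiples (2 * Real.pi * Complex.I)
  have hZ : IsDiscrete (Z : Set ℂ) := ⟨NormedSpace.discreteTopology_zmultiples _⟩
  have hm : MapsTo (fun z => g z - g' z) S (Z : Set ℂ) := by
    intro z hz
    obtain ⟨n, hn⟩ := Complex.exp_eq_exp_iff_exists_int.mp (he z hz)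
    refine AddSubgroup.mem_zmultiples_iff.mpr ⟨n, ?_⟩
    simp [hn]
  obtain ⟨c, hc, hcc⟩ := hS.eqOn_const_of_mapsTo hZ (hg.sub hg') hm ⟨0, Z.zero_mem⟩
  refine ⟨c, ?_, fun z hz => ?_⟩
  · obtain ⟨n, rfl⟩ := AddSubgroup.mem_zmultiples_iff.mp hc
    exact Complex.exp_eq_one_iff.mpr ⟨n, by simp⟩
  · have := hcc hz
    simp only [Function.const_apply, Pi.sub_apply] at this
    rw [← this]; ring

/-- Sliding the zero of the numerator along `γ` is a homotopy from the constant 1 that never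
vanishes on `S`. -/
lemma hasLogOn_div_of_path {S : Set ℂ} {a b : ℂ} (γ : Path a b) (hγ : Disjoint (range γ) S) :
    HasLogOn (fun z => (z - b) / (z - a)) S := by
  have hne : ∀ t, ∀ z ∈ S, z - γ t ≠ 0 := fun t z hz h =>
    Set.disjoint_left.mp hγ ⟨t, rfl⟩ (by rwa [← sub_eq_zero.mp h])
  have ha : ∀ z ∈ S, z - a ≠ 0 := by simpa using hne 0
  have := HasLogOn.of_homotopy (S := S) (h := fun t z => (z - γ t) / (z - a)) ?_ ?_ ?_
  · simpa using this
  · refine ContinuousOn.div (by fun_prop) (by fun_prop) ?_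
    rintro ⟨t, z⟩ ⟨-, hz⟩
    exact ha z hz
  · exact fun t z hz => div_ne_zero (hne t z hz) (ha z hz)
  · refine (HasLogOn.const one_ne_zero).congr ?_
    intro z hz
    simp [ha z hz]

lemma hasLogOn_univ {f : ℂ → ℂ} (hf : Continuous f) (h0 : ∀ z, f z ≠ 0) : HasLogOn f univ := by
  have := HasLogOn.of_homotopy (S := univ) (h := fun (t : unitInterval) z => f ((t : ℝ) * z))
    (by fun_prop) (fun t z _ => h0 _) (by simpa using HasLogOn.const (h0 0))
  simpa using this

lemma Path.continuousOn_invFun {X : Type*} [TopologicalSpace X] [T2Space X] {u v : X}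
    {γ : Path u v} (hγ : Function.Injective γ) :
    ContinuousOn (Function.invFun γ) (range γ) := by
  let e := (γ.continuous.isClosedEmbedding hγ).isEmbedding.toHomeomorph
  rw [continuousOn_iff_continuous_domRestrict]
  convert e.symm.continuous using 1
  ext ⟨z, t, rfl⟩ : 1
  have h2 : e.symm ⟨γ t, t, rfl⟩ = t := by
    rw [Homeomorph.symm_apply_eq]; rfl
  rw [h2]
  exact Function.leftInverse_invFun hγ t

/-- An arc is contractible: shrinking the parameter interval to 0 deforms `f ∘ γ` to a constant, and
injectivity carries the logarithm back to the arc. -/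
lemma hasLogOn_range_path {u v : ℂ} {γ : Path u v} (hγ : Function.Injective γ) {f : ℂ → ℂ}
    (hf : ContinuousOn f (range γ)) (h0 : ∀ z ∈ range γ, f z ≠ 0) : HasLogOn f (range γ) := by
  have hfγ : Continuous (fun t => f (γ t)) := hf.comp_continuous γ.continuous (fun t => ⟨t, rfl⟩)
  have := HasLogOn.of_homotopy (S := univ) (h := fun (t s : unitInterval) => f (γ (t * s)))
    (hfγ.comp (f := fun p : unitInterval × unitInterval => p.1 * p.2) (by fun_prop)).continuousOn
    (fun t s _ => h0 _ ⟨_, rfl⟩)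
    (by simpa using HasLogOn.const (h0 u ⟨0, by simp⟩))
  simp only [one_mul] at this
  obtain ⟨g, hg, he⟩ := this
  refine ⟨fun z => g (Function.invFun γ z),
    (continuousOn_univ.mp hg).comp_continuousOn (Path.continuousOn_invFun hγ), ?_⟩
  rintro z ⟨t, rfl⟩
  simp only [Function.leftInverse_invFun hγ t]
  exact he t trivial

/-- The winding number is `n`: along the circle a logarithm must be `n (log R + iθ)` up to a
constant, which grows by `2πin` in one turn although it returns to the same point. -/
lemma eq_zero_of_hasLogOn_sphere {a : ℂ} {R : ℝ} (hR : 0 < R) {n : ℤ}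
    (h : HasLogOn (fun z => (z - a) ^ n) (Metric.sphere a R)) : n = 0 := by
  obtain ⟨g, hg, he⟩ := h
  let c : ℝ → ℂ := fun θ => a + Complex.exp (Real.log R + θ * Complex.I)
  have hcs : ∀ θ, c θ ∈ Metric.sphere a R := by
    intro θ
    simp [c, Complex.norm_exp, Real.exp_log hR]
  have hc : Continuous c := by fun_prop
  obtain ⟨k, -, hk⟩ := exists_eqOn_add_of_exp_eq (S := (univ : Set ℝ)) isPreconnected_univ
    (g := fun θ => g (c θ)) (g' := fun θ => n * (Real.log R + θ * Complex.I))
    (hg.comp_continuous hc hcs).continuousOn (by fun_prop) (by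
      intro θ _
      rw [he _ (hcs θ), Complex.exp_int_mul]
      simp [c])
  have h1 := hk 0 trivial
  have h2 := hk (2 * Real.pi) trivial
  have h3 : c 0 = c (2 * Real.pi) := by
    simp only [c, Complex.exp_add]
    push_cast
    rw [Complex.exp_two_pi_mul_I]; simp
  simp only [h3] at h1
  rw [h2] at h1
  have h4 : (n : ℂ) * (2 * Real.pi * Complex.I) = 0 := by
    push_cast at h1
    linear_combination h1
  simpa [Complex.two_pi_I_ne_zero] using h4

lemma not_hasLogOn_compl_pair {u v : ℂ} (huv : u ≠ v) :
    ¬ HasLogOn (fun z => (z - v) / (z - u)) {u, v}ᶜ := by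
  intro h
  set r := ‖u - v‖ / 2
  have hr : 0 < r := by have := norm_pos_iff.mpr (sub_ne_zero.mpr huv); positivity
  have hre : ∀ z ∈ Metric.sphere u r, 1 / 2 ≤ ((z - v) / (u - v)).re := by
    intro z hz
    have h1 : (z - v) / (u - v) = 1 + (z - u) / (u - v) := by
      have := sub_ne_zero.mpr huv
      field_simp; ring
    -- The circle about `u` has half the distance to `v` as radius, so `(z - v) / (u - v)` stays in
    -- a right half-plane and the principal logarithm applies; only the winding of `z - u` is left.
    have h2 : ‖(z - u) / (u - v)‖ = 1 / 2 := by
      rw [norm_div, ← dist_eq_norm, Metric.mem_sphere.mp hz]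
      have := norm_pos_iff.mpr (sub_ne_zero.mpr huv)
      simp only [r]; field_simp
    have h3 := (abs_le.mp (Complex.abs_re_le_norm ((z - u) / (u - v)))).1
    rw [h1, Complex.add_re, Complex.one_re]
    linarith
  have hv : HasLogOn (fun z => (z - v) / (u - v)) (Metric.sphere u r) := by
    refine ⟨fun z => Complex.log ((z - v) / (u - v)), ?_, fun z hz => Complex.exp_log ?_⟩
    · refine ContinuousOn.clog (by fun_prop) fun z hz => Or.inl ?_
      linarith [hre z hz]
    · intro h0
      have := hre z hz
      rw [h0] at this; norm_num at this
  have hsub : Metric.sphere u r ⊆ {u, v}ᶜ := by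
    intro z hz hz'
    rcases hz' with rfl | rfl
    · simp at hz; linarith
    · have := hre z hz
      norm_num at this
  have hneg := ((h.mono hsub).mul (hv.zpow (-1))).zpow (-1)
  have : HasLogOn (fun z => (z - u) ^ (1 : ℤ)) (Metric.sphere u r) := by
    refine (hneg.mul (HasLogOn.const (sub_ne_zero.mpr huv))).congr ?_
    intro z hz
    have h1 : z - u ≠ 0 := fun h => hsub hz (Or.inl (sub_eq_zero.mp h))
    have h2 : z - v ≠ 0 := fun h => hsub hz (Or.inr (sub_eq_zero.mp h))
    have h3 := sub_ne_zero.mpr huv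
    simp only [zpow_neg, zpow_one]
    field_simp
  exact one_ne_zero (eq_zero_of_hasLogOn_sphere hr this)

/-- Logarithms on two closed sets that differ by a constant on the intersection can be glued. -/
lemma HasLogOn.union {f : ℂ → ℂ} {K A : Set ℂ} (hK : IsClosed K) (hA : IsClosed A)
    {g g' : ℂ → ℂ} {c : ℂ} (hg : ContinuousOn g K) (hg' : ContinuousOn g' A)
    (he : ∀ z ∈ K, Complex.exp (g z) = f z) (he' : ∀ z ∈ A, Complex.exp (g' z) = f z)
    (hc : Complex.exp c = 1) (h : ∀ z ∈ K ∩ A, g z = g' z + c) : HasLogOn f (K ∪ A) := by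
  classical
  have hgA : ∀ z ∈ A, (if z ∈ K then g z else g' z + c) = g' z + c := by
    intro z hz
    split_ifs with hzK
    · exact h z ⟨hzK, hz⟩
    · rfl
  refine ⟨fun z => if z ∈ K then g z else g' z + c, ?_, ?_⟩
  · refine ContinuousOn.union_of_isClosed ?_ ?_ hK hA
    · exact hg.congr fun z hz => by simp [hz]
    · exact (hg'.add continuousOn_const).congr hgA
  · rintro z (hz | hz)
    · simp [hz, he z hz]
    · simp only [hgA z hz, Complex.exp_add, he' z hz, hc, mul_one]

/-- If a set joins `u` to `v` inside a complementary open set `F` of a set joining `u` to `v`,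
it disconnects `F`. -/
lemma not_isPreconnected_diff {K A F : Set ℂ} {u v : ℂ} (huv : u ≠ v) (hA : IsClosed A)
    (hKuv : JoinedIn K u v) (hAuv : JoinedIn A u v) (hF : IsOpen F) (hFK : F ⊆ Kᶜ)
    (hAF : A \ {u, v} ⊆ F) : ¬ IsPreconnected (F \ A) := by
  classical
  intro hpre
  have key : ∀ B : Set ℂ, JoinedIn B u v → HasLogOn (fun z => (z - v) / (z - u)) Bᶜ := by
    intro B hB
    obtain ⟨γ, hγ⟩ := hB
    refine hasLogOn_div_of_path γ ?_
    rw [Set.disjoint_compl_right_iff_subset]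
    rintro _ ⟨t, rfl⟩
    exact hγ t
  obtain ⟨gX, hgX, heX⟩ := key A hAuv
  obtain ⟨gY, hgY, heY⟩ := key K hKuv
  have hsX : F \ A ⊆ Aᶜ := fun z hz => hz.2
  have hsY : F \ A ⊆ Kᶜ := fun z hz => hFK hz.1
  obtain ⟨c, hc, hcc⟩ := exists_eqOn_add_of_exp_eq hpre (hgX.mono hsX) (hgY.mono hsY)
    (fun z hz => (heX z (hsX hz)).trans (heY z (hsY hz)).symm)
  -- The logarithm off `K`, used on `F`, and the one off `A` differ by a constant on the overlap `F
  -- \ A`, so they glue to a logarithm on the plane minus two points, which does not exist.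
  have hcov : {u, v}ᶜ ⊆ F ∪ Aᶜ := by
    intro z hz
    by_cases hzA : z ∈ A
    · exact Or.inl (hAF ⟨hzA, hz⟩)
    · exact Or.inr hzA
  have hgX' : ∀ z ∈ Aᶜ, (if z ∈ F then gY z + c else gX z) = gX z := by
    intro z hz
    split_ifs with hzF
    · exact (hcc z ⟨hzF, hz⟩).symm
    · rfl
  refine not_hasLogOn_compl_pair huv ((?_ : HasLogOn _ (F ∪ Aᶜ)).mono hcov)
  refine ⟨fun z => if z ∈ F then gY z + c else gX z, ?_, ?_⟩
  · refine ContinuousOn.union_of_isOpen ?_ ?_ hF hA.isOpen_compl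
    · exact ((hgY.mono hFK).add continuousOn_const).congr fun z hz => if_pos hz
    · exact hgX.congr hgX'
  · rintro z (hz | hz)
    · simp only [hz, if_true, Complex.exp_add, hc, mul_one]
      exact heY z (hFK hz)
    · simp only [hgX' z hz]
      exact heX z hz

/-- A product `p * (z - a) ^ n` with a logarithm on the boundary of a bounded open set containing
`a` and with `p` nonvanishing inside has `n = 0`. -/
lemma eq_zero_of_hasLogOn_frontier {U K : Set ℂ} {a : ℂ} {n : ℤ} {p : ℂ → ℂ} (hU : IsOpen U)
    (hb : Bornology.IsBounded U) (ha : a ∈ U) (hK : IsClosed K) (hUK : frontier U ⊆ K)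
    (hp : ContinuousOn p (closure U)) (hp0 : ∀ z ∈ closure U, p z ≠ 0)
    (h : HasLogOn (fun z => p z * (z - a) ^ n) K) : n = 0 := by
  classical
  obtain ⟨g, hg, he⟩ := h
  obtain ⟨G, hG⟩ := ContinuousMap.exists_extension (hK.isClosedEmbedding_subtypeVal)
    (⟨K.domRestrict g, continuousOn_iff_continuous_domRestrict.mp hg⟩ : C(K, ℂ))
  have hGg : ∀ z ∈ K, G z = g z := fun z hz => congr_arg (fun F : C(K, ℂ) => F ⟨z, hz⟩) hG
  -- With `G` the Tietze extension of the logarithm, the two formulas agree on the frontier of `U`.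
  -- The result is continuous and nonvanishing on the plane, hence has a logarithm, yet equals `(z -
  -- a) ^ n` on a large circle.
  let H : ℂ → ℂ := U.piecewise (fun z => Complex.exp (G z) / p z) (fun z => (z - a) ^ n)
  have hane : ∀ z ∈ Uᶜ, z - a ≠ 0 := fun z hz h => hz (by rwa [sub_eq_zero.mp h])
  have hHc : Continuous H := by
    rw [← continuousOn_univ]
    refine ContinuousOn.piecewise ?_ ?_ ?_
    · rintro z ⟨-, hz⟩
      have hzU : z ∈ closure U := frontier_subset_closure hz
      have h0 := hp0 z hzU
      rw [hGg z (hUK hz), he z (hUK hz)]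
      field_simp
    · rw [univ_inter]
      exact (Complex.continuous_exp.comp G.continuous).continuousOn.div hp hp0
    · rw [univ_inter, hU.isClosed_compl.closure_eq]
      exact ContinuousOn.zpow₀ (by fun_prop) n fun z hz => Or.inl (hane z hz)
  have hH0 : ∀ z, H z ≠ 0 := by
    intro z
    by_cases hz : z ∈ U
    · simp only [H, piecewise_eq_of_mem _ _ _ hz]
      exact div_ne_zero (Complex.exp_ne_zero _) (hp0 z (subset_closure hz))
    · simp only [H, piecewise_eq_of_notMem _ _ _ hz]
      exact zpow_ne_zero _ (hane z hz)
  obtain ⟨R, hR, hUR⟩ := hb.subset_ball_lt 0 a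
  refine eq_zero_of_hasLogOn_sphere (a := a) hR (((hasLogOn_univ hHc hH0).mono (subset_univ _)).congr ?_)
  intro z hz
  have hzU : z ∉ U := fun h => by
    have h1 := Metric.mem_ball.mp (hUR h)
    have h2 := Metric.mem_sphere.mp hz
    linarith
  simp only [H, piecewise_eq_of_notMem _ _ _ hzU]

/-! ### Complementary components and Eilenberg's criterion -/

lemma isPreconnected_norm_gt {R : ℝ} (hR : 0 < R) : IsPreconnected {z : ℂ | R < ‖z‖} := by
  have h1 : IsPreconnected {w : ℂ | Real.log R < w.re} :=
    (convex_halfSpace_re_gt _).isPreconnected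
  have h2 := h1.image Complex.exp Complex.continuous_exp.continuousOn
  convert h2 using 1
  ext z
  constructor
  · intro hz
    have hz : R < ‖z‖ := hz
    have hz0 : z ≠ 0 := by rintro rfl; simp at hz; linarith
    exact ⟨Complex.log z, by simpa [Complex.log_re] using Real.log_lt_log hR hz,
      Complex.exp_log hz0⟩
  · rintro ⟨w, hw, rfl⟩
    change R < ‖_‖
    rw [Complex.norm_exp]
    exact (Real.log_lt_iff_lt_exp hR).mp hw

lemma connectedComponentIn_compl_eq_of_not_isBounded {K : Set ℂ} (hK : Bornology.IsBounded K)
    {a b : ℂ} (ha : ¬ Bornology.IsBounded (connectedComponentIn Kᶜ a))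
    (hb : ¬ Bornology.IsBounded (connectedComponentIn Kᶜ b)) :
    connectedComponentIn Kᶜ a = connectedComponentIn Kᶜ b := by
  obtain ⟨R, hR, hKR⟩ := hK.subset_closedBall_lt 0 0
  have hsub : {z : ℂ | R < ‖z‖} ⊆ Kᶜ := by
    intro z hz hzK
    have := hKR hzK
    simp at this
    exact absurd hz (not_lt.mpr this)
  have key : ∀ c, ¬ Bornology.IsBounded (connectedComponentIn Kᶜ c) →
      (((R + 1 : ℝ) : ℂ)) ∈ connectedComponentIn Kᶜ c := by
    intro c hc
    have : ∃ x ∈ connectedComponentIn Kᶜ c, R < ‖x‖ := by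
      by_contra! hcon
      exact hc ((Metric.isBounded_closedBall (x := 0) (r := R)).subset
        fun x hx => by simpa using hcon x hx)
    obtain ⟨x, hx, hxR⟩ := this
    rw [connectedComponentIn_eq hx]
    refine (isPreconnected_norm_gt hR).subset_connectedComponentIn hxR hsub ?_
    change R < ‖((R + 1 : ℝ) : ℂ)‖
    rw [Complex.norm_real, Real.norm_eq_abs, abs_of_pos (by linarith)]
    linarith
  rw [connectedComponentIn_eq (key a ha), connectedComponentIn_eq (key b hb)]

section Components

variable {W : Set ℂ} {a b : ℂ}

lemma closure_connectedComponentIn_inter_subset :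
    closure (connectedComponentIn W a) ∩ W ⊆ connectedComponentIn W a := by
  intro x hx
  have hne : (connectedComponentIn W a).Nonempty := by
    rw [← closure_nonempty_iff]; exact ⟨x, hx.1⟩
  have ha : a ∈ W := connectedComponentIn_nonempty_iff.mp hne
  refine IsPreconnected.subset_connectedComponentIn
    (s := closure (connectedComponentIn W a) ∩ W) ?_ ?_ inter_subset_right hx
  · exact isPreconnected_connectedComponentIn.subset_closure
      (fun y hy => ⟨subset_closure hy, connectedComponentIn_subset _ _ hy⟩) inter_subset_left
  · exact ⟨subset_closure (mem_connectedComponentIn ha), ha⟩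

lemma frontier_connectedComponentIn_subset (hW : IsOpen W) :
    frontier (connectedComponentIn W a) ⊆ Wᶜ := by
  intro x hx hxW
  have hU : IsOpen (connectedComponentIn W a) := hW.connectedComponentIn
  rw [hU.frontier_eq] at hx
  exact hx.2 (closure_connectedComponentIn_inter_subset ⟨hx.1, hxW⟩)

lemma notMem_closure_connectedComponentIn (hb : b ∈ W)
    (hab : connectedComponentIn W a ≠ connectedComponentIn W b) :
    b ∉ closure (connectedComponentIn W a) := fun h =>
  hab (connectedComponentIn_eq (closure_connectedComponentIn_inter_subset ⟨h, hb⟩))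

/-- The factors at `b` and `c` do not vanish on the closure of the component of `a`, since these
points lie in other components. Two such points are needed later, to exclude three components at
once. -/
lemma eq_zero_of_hasLogOn_mul {K : Set ℂ} (hK : IsClosed K) {a b c : ℂ} {n k l : ℤ}
    (ha : a ∉ K) (hb : b ∉ K) (hc : c ∉ K)
    (hbd : Bornology.IsBounded (connectedComponentIn Kᶜ a))
    (hab : connectedComponentIn Kᶜ a ≠ connectedComponentIn Kᶜ b)
    (hac : connectedComponentIn Kᶜ a ≠ connectedComponentIn Kᶜ c)
    (h : HasLogOn (fun z => (z - b) ^ k * (z - c) ^ l * (z - a) ^ n) K) : n = 0 := by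
  have hbz : ∀ z ∈ closure (connectedComponentIn Kᶜ a), z - b ≠ 0 := fun z hz h =>
    notMem_closure_connectedComponentIn hb hab (by rwa [← sub_eq_zero.mp h])
  have hcz : ∀ z ∈ closure (connectedComponentIn Kᶜ a), z - c ≠ 0 := fun z hz h =>
    notMem_closure_connectedComponentIn hc hac (by rwa [← sub_eq_zero.mp h])
  refine eq_zero_of_hasLogOn_frontier hK.isOpen_compl.connectedComponentIn hbd
    (mem_connectedComponentIn ha) hK ?_ ?_ ?_ h
  · simpa using frontier_connectedComponentIn_subset (a := a) hK.isOpen_compl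
  · exact (ContinuousOn.zpow₀ (by fun_prop) k fun z hz => Or.inl (hbz z hz)).mul
      (ContinuousOn.zpow₀ (by fun_prop) l fun z hz => Or.inl (hcz z hz))
  · exact fun z hz => mul_ne_zero (zpow_ne_zero _ (hbz z hz)) (zpow_ne_zero _ (hcz z hz))

/-- Eilenberg's criterion. -/
lemma connectedComponentIn_eq_of_hasLogOn {K : Set ℂ} (hK : IsCompact K) {a b : ℂ}
    (ha : a ∉ K) (hb : b ∉ K) (h : HasLogOn (fun z => (z - a) / (z - b)) K) :
    connectedComponentIn Kᶜ a = connectedComponentIn Kᶜ b := by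
  by_contra hab
  -- Only one complementary component can be unbounded; the winding argument runs in a bounded one,
  -- with exponent 1 or -1.
  have hsplit : Bornology.IsBounded (connectedComponentIn Kᶜ a) ∨
      Bornology.IsBounded (connectedComponentIn Kᶜ b) := by
    by_contra! hcon
    exact hab (connectedComponentIn_compl_eq_of_not_isBounded hK.isBounded hcon.1 hcon.2)
  rcases hsplit with hbd | hbd
  · refine one_ne_zero (eq_zero_of_hasLogOn_mul (n := 1) (k := -1) (l := 0) hK.isClosed
      ha hb hb hbd hab hab (h.congr fun z hz => ?_))
    simp [div_eq_mul_inv, mul_comm]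
  · refine absurd (eq_zero_of_hasLogOn_mul (n := -1) (k := 1) (l := 0) hK.isClosed
      hb ha ha hbd (Ne.symm hab) (Ne.symm hab) (h.congr fun z hz => ?_)) (by norm_num)
    simp [div_eq_mul_inv]

end Components

/-! ### Logarithms on a compact set with an attached arc -/

section Arc

variable {K F : Set ℂ} {u v : ℂ} {γ : Path u v}

lemma hasLogOn_div_of_mem (hF : IsOpen F) (hFc : IsPreconnected F) (hFK : F ⊆ Kᶜ) {a b : ℂ}
    (ha : a ∈ F) (hb : b ∈ F) : HasLogOn (fun z => (z - a) / (z - b)) K := by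
  have hpc : IsPathConnected F := hF.isConnected_iff_isPathConnected.mp ⟨⟨a, ha⟩, hFc⟩
  obtain ⟨δ, hδ⟩ := hpc.joinedIn b hb a ha
  refine hasLogOn_div_of_path δ ?_
  rw [Set.disjoint_left]
  rintro _ ⟨t, rfl⟩ h
  exact hFK (hδ t) h

lemma hasLogOn_div_arc (hγ : Function.Injective γ) {a b : ℂ} (ha : a ∉ range γ)
    (hb : b ∉ range γ) : HasLogOn (fun z => (z - a) / (z - b)) (range γ) := by
  have h : ∀ c ∉ range γ, ∀ z ∈ range γ, z - c ≠ 0 := fun c hc z hz h =>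
    hc (by rwa [← sub_eq_zero.mp h])
  exact hasLogOn_range_path hγ (ContinuousOn.div (by fun_prop) (by fun_prop) (h b hb))
    fun z hz => div_ne_zero (h a ha z hz) (h b hb z hz)

lemma isCompact_range_path : IsCompact (range γ) := isCompact_range γ.continuous

/-- An arc joining two separated parts of a compact set does not disconnect a complementary
component. -/
lemma connectedComponentIn_eq_of_separated {K₁ K₂ : Set ℂ} (hγ : Function.Injective γ)
    (hK₁ : IsCompact K₁) (hK₂ : IsCompact K₂) (hd : Disjoint K₁ K₂) (hu : u ∈ K₁) (hv : v ∈ K₂)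
    (hKγ : (K₁ ∪ K₂) ∩ range γ ⊆ {u, v}) (hF : IsOpen F) (hFc : IsPreconnected F)
    (hFK : F ⊆ (K₁ ∪ K₂)ᶜ) {a b : ℂ} (ha : a ∈ F \ range γ) (hb : b ∈ F \ range γ) :
    connectedComponentIn (K₁ ∪ K₂ ∪ range γ)ᶜ a =
      connectedComponentIn (K₁ ∪ K₂ ∪ range γ)ᶜ b := by
  obtain ⟨g, hg, he⟩ := hasLogOn_div_of_mem hF hFc hFK ha.1 hb.1
  obtain ⟨g', hg', he'⟩ := hasLogOn_div_arc hγ ha.2 hb.2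
  have hA : IsCompact (range γ) := isCompact_range_path
  have hu' : u ∈ range γ := ⟨0, by simp⟩
  have hv' : v ∈ range γ := ⟨1, by simp⟩
  have hexp : ∀ z ∈ K₁ ∪ K₂, z ∈ range γ → Complex.exp (g z - g' z) = 1 := by
    intro z hz hzA
    rw [Complex.exp_sub, he z hz, ← he' z hzA, div_self (Complex.exp_ne_zero _)]
  -- Each of the two gluings takes place at a single point, `u` and then `v`, so one additive
  -- constant suffices each time.
  have hlog₁ : HasLogOn (fun z => (z - a) / (z - b)) (range γ ∪ K₁) := by
    have := HasLogOn.union hK₁.isClosed hA.isClosed (hg.mono subset_union_left) hg'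
      (fun z hz => he z (Or.inl hz)) he' (hexp u (Or.inl hu) hu') ?_
    · rwa [union_comm]
    · intro z hz
      rcases hKγ ⟨Or.inl hz.1, hz.2⟩ with rfl | rfl
      · ring
      · exact absurd hv (Set.disjoint_left.mp hd hz.1)
  obtain ⟨g'', hg'', he''⟩ := hlog₁
  have hlog : HasLogOn (fun z => (z - a) / (z - b)) (K₂ ∪ (range γ ∪ K₁)) := by
    refine HasLogOn.union (c := g v - g'' v) hK₂.isClosed (hA.union hK₁).isClosed
      (hg.mono subset_union_right) hg'' (fun z hz => he z (Or.inr hz)) he'' ?_ ?_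
    · rw [Complex.exp_sub, he v (Or.inr hv), ← he'' v (Or.inl hv'),
        div_self (Complex.exp_ne_zero _)]
    · rintro z ⟨hz, hz' | hz'⟩
      · rcases hKγ ⟨Or.inr hz, hz'⟩ with rfl | rfl
        · exact absurd hz (Set.disjoint_left.mp hd hu)
        · ring
      · exact absurd hz (Set.disjoint_left.mp hd hz')
  have hset : K₂ ∪ (range γ ∪ K₁) = K₁ ∪ K₂ ∪ range γ := by
    ext z; simp only [mem_union]; tauto
  rw [hset] at hlog
  refine connectedComponentIn_eq_of_hasLogOn ((hK₁.union hK₂).union hA) ?_ ?_ hlog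
  · rintro (h | h)
    exacts [hFK ha.1 h, ha.2 h]
  · rintro (h | h)
    exacts [hFK hb.1 h, hb.2 h]

/-- An arc with its ends on a compact set splits a complementary component in at most two
parts. -/
lemma connectedComponentIn_eq_or_eq_or_eq (hγ : Function.Injective γ) (hK : IsCompact K)
    (hu : u ∈ K) (hv : v ∈ K) (hKγ : K ∩ range γ ⊆ {u, v}) (hF : IsOpen F)
    (hFc : IsPreconnected F) (hFK : F ⊆ Kᶜ) {a b c : ℂ} (ha : a ∈ F \ range γ)
    (hb : b ∈ F \ range γ) (hc : c ∈ F \ range γ) :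
    connectedComponentIn (K ∪ range γ)ᶜ a = connectedComponentIn (K ∪ range γ)ᶜ b ∨
    connectedComponentIn (K ∪ range γ)ᶜ c = connectedComponentIn (K ∪ range γ)ᶜ b ∨
    connectedComponentIn (K ∪ range γ)ᶜ a = connectedComponentIn (K ∪ range γ)ᶜ c := by
  by_contra! hne
  obtain ⟨hab, hcb, hac⟩ := hne
  have hA : IsCompact (range γ) := isCompact_range_path
  have hKA := hK.union hA
  have hnot : ∀ x ∈ F \ range γ, x ∉ K ∪ range γ := by
    rintro x hx (h | h)
    exacts [hFK hx.1 h, hx.2 h]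
  have hu' : u ∈ range γ := ⟨0, by simp⟩
  have hv' : v ∈ range γ := ⟨1, by simp⟩
  -- The logarithms on `K` and on the arc differ by multiples `i` and `j` of `2πi` at the ends `u`
  -- and `v`; they glue if `i = j`, so `i - j` is the obstruction to `x` and `b` lying in one
  -- component.
  have key : ∀ x ∈ F \ range γ, ∃ g g' : ℂ → ℂ, ∃ i j : ℤ, ContinuousOn g K ∧
      ContinuousOn g' (range γ) ∧ (∀ z ∈ K, Complex.exp (g z) = (z - x) / (z - b)) ∧
      (∀ z ∈ range γ, Complex.exp (g' z) = (z - x) / (z - b)) ∧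
      g u = g' u + i * (2 * Real.pi * Complex.I) ∧
      g v = g' v + j * (2 * Real.pi * Complex.I) := by
    intro x hx
    obtain ⟨g, hg, he⟩ := hasLogOn_div_of_mem hF hFc hFK hx.1 hb.1
    obtain ⟨g', hg', he'⟩ := hasLogOn_div_arc hγ hx.2 hb.2
    obtain ⟨i, hi⟩ := Complex.exp_eq_exp_iff_exists_int.mp ((he u hu).trans (he' u hu').symm)
    obtain ⟨j, hj⟩ := Complex.exp_eq_exp_iff_exists_int.mp ((he v hv).trans (he' v hv').symm)
    exact ⟨g, g', i, j, hg, hg', he, he', hi, hj⟩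
  obtain ⟨ga, ga', ia, ja, hga, hga', hea, hea', hia, hja⟩ := key a ha
  obtain ⟨gc, gc', ic, jc, hgc, hgc', hec, hec', hic, hjc⟩ := key c hc
  have hexp : ∀ n : ℤ, Complex.exp (n * (2 * Real.pi * Complex.I)) = 1 :=
    Complex.exp_int_mul_two_pi_mul_I
  have hda : ia - ja ≠ 0 := by
    intro h
    refine hab (connectedComponentIn_eq_of_hasLogOn hKA (hnot a ha) (hnot b hb)
      (HasLogOn.union hK.isClosed hA.isClosed hga hga' hea hea' (hexp ia) ?_))
    intro z hz
    rcases hKγ hz with rfl | rfl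
    · exact hia
    · rw [hja, sub_eq_zero.mp h]
  have hdc : ic - jc ≠ 0 := by
    intro h
    refine hcb (connectedComponentIn_eq_of_hasLogOn hKA (hnot c hc) (hnot b hb)
      (HasLogOn.union hK.isClosed hA.isClosed hgc hgc' hec hec' (hexp ic) ?_))
    intro z hz
    rcases hKγ hz with rfl | rfl
    · exact hic
    · rw [hjc, sub_eq_zero.mp h]
  -- The exponents are chosen to cancel the two obstructions: `(ic - jc) (ia - ja) - (ia - ja) (ic -
  -- jc) = 0`. One of `a` and `c` lies in a bounded component, where a logarithm forces its exponent
  -- to be 0.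
  have hlog : HasLogOn (fun z => ((z - a) / (z - b)) ^ (ic - jc) *
      ((z - c) / (z - b)) ^ (-(ia - ja))) (K ∪ range γ) := by
    refine HasLogOn.union (g := fun z => (ic - jc : ℤ) * ga z + (-(ia - ja) : ℤ) * gc z)
      (g' := fun z => (ic - jc : ℤ) * ga' z + (-(ia - ja) : ℤ) * gc' z)
      (c := ((ic - jc) * ia - (ia - ja) * ic : ℤ) * (2 * Real.pi * Complex.I))
      hK.isClosed hA.isClosed (by fun_prop) (by fun_prop) ?_ ?_ (hexp _) ?_
    · intro z hz
      rw [Complex.exp_add, Complex.exp_int_mul, Complex.exp_int_mul, hea z hz, hec z hz]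
    · intro z hz
      rw [Complex.exp_add, Complex.exp_int_mul, Complex.exp_int_mul, hea' z hz, hec' z hz]
    · intro z hz
      rcases hKγ hz with rfl | rfl
      · rw [hia, hic]; push_cast; ring
      · rw [hja, hjc]; push_cast; ring
  have hbz : ∀ z ∈ K ∪ range γ, z - b ≠ 0 := fun z hz h =>
    hnot b hb (by rwa [← sub_eq_zero.mp h])
  by_cases hbd : Bornology.IsBounded (connectedComponentIn (K ∪ range γ)ᶜ a)
  · refine hdc (eq_zero_of_hasLogOn_mul (k := (ia - ja) - (ic - jc)) (l := -(ia - ja))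
      hKA.isClosed (hnot a ha) (hnot b hb) (hnot c hc) hbd hab hac (hlog.congr fun z hz => ?_))
    generalize ia - ja = m
    generalize ic - jc = n
    rw [div_zpow, div_zpow, zpow_sub₀ (hbz z hz), zpow_neg, zpow_neg]
    have h1 := zpow_ne_zero m (hbz z hz)
    have h2 := zpow_ne_zero n (hbz z hz)
    field_simp
  · have hbd' : Bornology.IsBounded (connectedComponentIn (K ∪ range γ)ᶜ c) := by
      by_contra hcon
      exact hac (connectedComponentIn_compl_eq_of_not_isBounded hKA.isBounded hbd hcon)
    refine hda (neg_eq_zero.mp (eq_zero_of_hasLogOn_mul (k := (ia - ja) - (ic - jc))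
      (l := ic - jc) hKA.isClosed (hnot c hc) (hnot b hb) (hnot a ha) hbd' hcb
      (Ne.symm hac) (hlog.congr fun z hz => ?_)))
    generalize ia - ja = m
    generalize ic - jc = n
    rw [div_zpow, div_zpow, zpow_sub₀ (hbz z hz), zpow_neg, zpow_neg]
    have h1 := zpow_ne_zero m (hbz z hz)
    have h2 := zpow_ne_zero n (hbz z hz)
    field_simp

/-- A disc in the arc would contain a circle on which the parameter is an injective continuous real
function; by the intermediate value theorem such a function takes equal values at some antipodal
pair. -/
lemma interior_range_arc (hγ : Function.Injective γ) : interior (range γ) = ∅ := by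
  by_contra hne
  obtain ⟨a, ha⟩ := Set.nonempty_iff_ne_empty.mpr hne
  obtain ⟨r, hr, hball⟩ := Metric.isOpen_iff.mp isOpen_interior a ha
  have hsub : Metric.sphere a (r / 2) ⊆ range γ := by
    intro z hz
    refine interior_subset (hball ?_)
    rw [Metric.mem_ball, Metric.mem_sphere.mp hz]; linarith
  let h : ℂ → ℝ := fun z => (Function.invFun γ z : unitInterval)
  have hh : ContinuousOn h (range γ) :=
    continuous_subtype_val.comp_continuousOn (Path.continuousOn_invFun hγ)
  have hinj : ∀ x ∈ range γ, ∀ y ∈ range γ, h x = h y → x = y := by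
    rintro _ ⟨s, rfl⟩ _ ⟨t, rfl⟩ hst
    have h1 : ∀ t, Function.invFun γ (γ t) = t := Function.leftInverse_invFun hγ
    simp only [h, h1] at hst
    rw [Subtype.ext hst]
  have hmaps : ∀ z ∈ Metric.sphere a (r / 2), 2 * a - z ∈ Metric.sphere a (r / 2) := by
    intro z hz
    rw [mem_sphere_iff_norm] at hz ⊢
    rw [← hz, ← norm_neg]; congr 1; ring
  have hpre : IsPreconnected (Metric.sphere a (r / 2)) := isPreconnected_sphere (by simp) _ _
  have hcont : ContinuousOn (fun z => h z - h (2 * a - z)) (Metric.sphere a (r / 2)) :=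
    (hh.mono hsub).sub ((hh.mono hsub).comp (by fun_prop) hmaps)
  have hx : a + (r / 2 : ℝ) ∈ Metric.sphere a (r / 2) := by
    simp [abs_of_pos hr]
  have hy := hmaps _ hx
  obtain ⟨z, hz, hz0⟩ : (0 : ℝ) ∈ (fun z => h z - h (2 * a - z)) '' Metric.sphere a (r / 2) := by
    have hI := (hpre.image _ hcont).ordConnected
    have h1 := mem_image_of_mem (fun z => h z - h (2 * a - z)) hx
    have h2 := mem_image_of_mem (fun z => h z - h (2 * a - z)) hy
    simp only [sub_sub_cancel] at h2
    rcases le_total 0 (h (a + (r / 2 : ℝ)) - h (2 * a - (a + (r / 2 : ℝ)))) with h0 | h0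
    · exact hI.out h2 h1 ⟨by linarith, h0⟩
    · exact hI.out h1 h2 ⟨h0, by linarith⟩
  have heq := hinj z (hsub hz) _ (hsub (hmaps z hz)) (sub_eq_zero.mp hz0)
  have hza : z = a := by linear_combination heq / 2
  rw [hza] at hz
  simp at hz
  linarith

end Arc

/-! ### How an attached arc changes the faces -/

/-- The connected components of a subset of the plane. -/
def componentsIn (W : Set ℂ) : Set (Set ℂ) := {F | ∃ z ∈ W, F = connectedComponentIn W z}

section componentsIn

variable {W F F' : Set ℂ} {z : ℂ}

lemma connectedComponentIn_mem_componentsIn (hz : z ∈ W) :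
    connectedComponentIn W z ∈ componentsIn W := ⟨z, hz, rfl⟩

lemma eq_connectedComponentIn (hF : F ∈ componentsIn W) (hz : z ∈ F) :
    F = connectedComponentIn W z := by
  obtain ⟨w, -, rfl⟩ := hF
  exact connectedComponentIn_eq hz

lemma componentsIn.nonempty (hF : F ∈ componentsIn W) : F.Nonempty := by
  obtain ⟨w, hw, rfl⟩ := hF
  exact ⟨w, mem_connectedComponentIn hw⟩

lemma componentsIn.isPreconnected (hF : F ∈ componentsIn W) : IsPreconnected F := by
  obtain ⟨w, hw, rfl⟩ := hF
  exact isPreconnected_connectedComponentIn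

lemma componentsIn.subset (hF : F ∈ componentsIn W) : F ⊆ W := by
  obtain ⟨w, hw, rfl⟩ := hF
  exact connectedComponentIn_subset _ _

lemma componentsIn.isOpen (hF : F ∈ componentsIn W) (hW : IsOpen W) : IsOpen F := by
  obtain ⟨w, hw, rfl⟩ := hF
  exact hW.connectedComponentIn

lemma componentsIn.closure_inter_subset (hF : F ∈ componentsIn W) : closure F ∩ W ⊆ F := by
  obtain ⟨w, hw, rfl⟩ := hF
  exact closure_connectedComponentIn_inter_subset

lemma componentsIn.frontier_subset (hF : F ∈ componentsIn W) (hW : IsOpen W) :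
    frontier F ⊆ Wᶜ := by
  obtain ⟨w, hw, rfl⟩ := hF
  exact frontier_connectedComponentIn_subset hW

lemma componentsIn.eq_of_mem (hF : F ∈ componentsIn W) (hF' : F' ∈ componentsIn W)
    (hz : z ∈ F) (hz' : z ∈ F') : F = F' := by
  rw [eq_connectedComponentIn hF hz, eq_connectedComponentIn hF' hz']

lemma mem_componentsIn (hne : F.Nonempty) (hF : IsPreconnected F) (hFW : F ⊆ W)
    (hsub : ∀ z ∈ F, connectedComponentIn W z ⊆ F) : F ∈ componentsIn W := by
  obtain ⟨z, hz⟩ := hne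
  exact ⟨z, hFW hz, (hF.subset_connectedComponentIn hz hFW).antisymm (hsub z hz)⟩

lemma mem_componentsIn_of_isOpen (hne : F.Nonempty) (hF : IsPreconnected F) (hFo : IsOpen F)
    (hFW : F ⊆ W) (hcl : closure F ∩ W ⊆ F) : F ∈ componentsIn W := by
  refine mem_componentsIn hne hF hFW fun z hz => ?_
  refine isPreconnected_connectedComponentIn.subset_of_closure_inter_subset hFo
    ⟨z, mem_connectedComponentIn (hFW hz), hz⟩ ?_
  exact fun x hx => hcl ⟨hx.1, connectedComponentIn_subset _ _ hx.2⟩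

end componentsIn

section Arc

variable {K : Set ℂ} {u v : ℂ} {γ : Path u v}

lemma Path.range_eq_image_extend : range γ = γ.extend '' Icc 0 1 := by
  ext z
  constructor
  · rintro ⟨t, rfl⟩
    exact ⟨t, t.2, by simp⟩
  · rintro ⟨t, ht, rfl⟩
    exact ⟨⟨t, ht⟩, by simp [Path.extend_apply, ht]⟩

lemma Path.injOn_extend (hγ : Function.Injective γ) : InjOn γ.extend (Icc 0 1) := by
  intro s hs t ht hst
  rw [Path.extend_apply _ hs, Path.extend_apply _ ht] at hst
  exact congr_arg Subtype.val (hγ hst)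

lemma Path.range_diff_eq_image_extend (hγ : Function.Injective γ) :
    range γ \ {u, v} = γ.extend '' Ioo 0 1 := by
  have hinj := Path.injOn_extend hγ
  have h0 : γ.extend 0 = u := by simp
  have h1 : γ.extend 1 = v := by simp
  rw [Path.range_eq_image_extend]
  ext z
  constructor
  · rintro ⟨⟨t, ht, rfl⟩, hne⟩
    refine ⟨t, ⟨lt_of_le_of_ne ht.1 ?_, lt_of_le_of_ne ht.2 ?_⟩, rfl⟩
    · rintro rfl; exact hne (Or.inl h0)
    · rintro rfl; exact hne (Or.inr h1)
  · rintro ⟨t, ht, rfl⟩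
    have htI := Ioo_subset_Icc_self ht
    refine ⟨⟨t, htI, rfl⟩, ?_⟩
    rintro (h | h)
    · exact ht.1.ne (hinj htI (by simp) (h.trans h0.symm)).symm
    · exact ht.2.ne (hinj htI (by simp) (h.trans h1.symm))

lemma Path.ne_of_injective (hγ : Function.Injective γ) : u ≠ v := by
  intro h
  have : γ 0 = γ 1 := by simpa using h
  exact zero_ne_one (hγ this)

/-- The component of the complement of `K` that contains the interior of the arc `γ`. -/
noncomputable def arcFace (K : Set ℂ) (γ : Path u v) : Set ℂ :=
  connectedComponentIn Kᶜ (γ.extend (1 / 2))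

/-- The components of the complement of `K ∪ γ` into which `γ` divides the face of `K` containing
the interior of `γ`. -/
def arcParts (K : Set ℂ) (γ : Path u v) : Set (Set ℂ) :=
  {F ∈ componentsIn (K ∪ range γ)ᶜ | F ⊆ arcFace K γ}

lemma subset_diff_of_mem_arcParts {F : Set ℂ} (hF : F ∈ arcParts K γ) : F ⊆ arcFace K γ \ range γ :=
  fun _ hz => ⟨hF.2 hz, fun h' => componentsIn.subset hF.1 hz (Or.inr h')⟩

/-- Adding to a closed set a second connection between two of its points divides a face. -/
lemma exists_connectedComponentIn_ne {A F : Set ℂ} {x y : ℂ} (hxy : x ≠ y) (hA : IsClosed A)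
    {K' : Set ℂ} (hF : F ∈ componentsIn K'ᶜ) (hK' : IsClosed K')
    (hKxy : JoinedIn K' x y) (hAxy : JoinedIn A x y)
    (hAF : A \ {x, y} ⊆ F) (hKA : K' ∪ A = K ∪ range γ) :
    ∃ a ∈ F \ A, ∃ b ∈ F \ A, connectedComponentIn (K ∪ range γ)ᶜ a ≠
      connectedComponentIn (K ∪ range γ)ᶜ b := by
  by_contra! hcon
  refine not_isPreconnected_diff hxy hA hKxy hAxy (componentsIn.isOpen hF hK'.isOpen_compl)
    (componentsIn.subset hF) hAF ?_
  rcases (F \ A).eq_empty_or_nonempty with hemp | ⟨a, ha⟩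
  · rw [hemp]; exact isPreconnected_empty
  · have heq : F \ A = connectedComponentIn (K ∪ range γ)ᶜ a := by
      apply Subset.antisymm
      · intro b hb
        rw [hcon a ha b hb]
        refine mem_connectedComponentIn ?_
        rw [← hKA]
        exact fun h' => h'.elim (componentsIn.subset hF hb.1) hb.2
      · intro b hb
        have hbW := connectedComponentIn_subset _ _ hb
        rw [← hKA] at hb hbW
        refine ⟨?_, fun h' => hbW (Or.inr h')⟩
        rw [eq_connectedComponentIn hF ha.1]
        exact connectedComponentIn_mono _ (compl_subset_compl.mpr subset_union_left) hb
    rw [heq]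
    exact isPreconnected_connectedComponentIn

/-- An arc that has exactly its ends in common with a compact set. -/
structure IsAttached (K : Set ℂ) (γ : Path u v) : Prop where
  injective : Function.Injective γ
  isCompact : IsCompact K
  left_mem : u ∈ K
  right_mem : v ∈ K
  inter_subset : K ∩ range γ ⊆ {u, v}

namespace IsAttached

variable (h : IsAttached K γ)
include h

lemma isCompact_union : IsCompact (K ∪ range γ) := h.isCompact.union isCompact_range_path

lemma image_extend_subset : γ.extend '' Ioo 0 1 ⊆ Kᶜ := by
  rw [← Path.range_diff_eq_image_extend h.injective]
  exact fun z hz hzK => hz.2 (h.inter_subset ⟨hzK, hz.1⟩)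

lemma extend_half_mem : γ.extend (1 / 2) ∈ Kᶜ :=
  h.image_extend_subset ⟨1 / 2, by norm_num, rfl⟩

lemma arcFace_mem : arcFace K γ ∈ componentsIn Kᶜ :=
  connectedComponentIn_mem_componentsIn h.extend_half_mem

lemma isOpen_arcFace : IsOpen (arcFace K γ) :=
  componentsIn.isOpen h.arcFace_mem h.isCompact.isClosed.isOpen_compl

lemma diff_subset_arcFace : range γ \ {u, v} ⊆ arcFace K γ := by
  rw [Path.range_diff_eq_image_extend h.injective]
  refine IsPreconnected.subset_connectedComponentIn ?_ ⟨1 / 2, by norm_num, rfl⟩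
    h.image_extend_subset
  exact isPreconnected_Ioo.image _ γ.continuous_extend.continuousOn

lemma eq_arcFace {G : Set ℂ} (hG : G ∈ componentsIn Kᶜ) {z : ℂ} (hz : z ∈ G)
    (hzγ : z ∈ range γ) : G = arcFace K γ := by
  refine componentsIn.eq_of_mem hG h.arcFace_mem hz (h.diff_subset_arcFace ⟨hzγ, fun hz' => ?_⟩)
  have hzK : z ∉ K := componentsIn.subset hG hz
  rcases hz' with rfl | rfl
  exacts [hzK h.left_mem, hzK h.right_mem]

lemma connectedComponentIn_mem_arcParts {z : ℂ} (hz : z ∈ arcFace K γ \ range γ) :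
    connectedComponentIn (K ∪ range γ)ᶜ z ∈ arcParts K γ := by
  have hzK : z ∈ Kᶜ := componentsIn.subset h.arcFace_mem hz.1
  refine ⟨connectedComponentIn_mem_componentsIn fun h' => h'.elim hzK hz.2, ?_⟩
  rw [eq_connectedComponentIn h.arcFace_mem hz.1]
  exact connectedComponentIn_mono _ (compl_subset_compl.mpr subset_union_left)

lemma diff_nonempty : (arcFace K γ \ range γ).Nonempty := by
  by_contra hne
  rw [not_nonempty_iff_eq_empty, sdiff_eq_empty] at hne
  have := (h.isOpen_arcFace.subset_interior_iff).mpr hne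
  rw [interior_range_arc h.injective] at this
  exact (componentsIn.nonempty h.arcFace_mem).ne_empty (subset_empty_iff.mp this)

lemma arcParts_nonempty : (arcParts K γ).Nonempty :=
  let ⟨_, hz⟩ := h.diff_nonempty
  ⟨_, h.connectedComponentIn_mem_arcParts hz⟩

/-- The arc without its ends is connected and avoids `K`, so it lies in a single face; every other
face survives unchanged. -/
lemma componentsIn_eq :
    componentsIn (K ∪ range γ)ᶜ = (componentsIn Kᶜ \ {arcFace K γ}) ∪ arcParts K γ := by
  have hsub : (K ∪ range γ)ᶜ ⊆ Kᶜ := compl_subset_compl.mpr subset_union_left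
  have hmem : ∀ G ∈ componentsIn Kᶜ \ {arcFace K γ}, G ∈ componentsIn (K ∪ range γ)ᶜ := by
    rintro G ⟨hG, hne⟩
    refine mem_componentsIn (componentsIn.nonempty hG) (componentsIn.isPreconnected hG) ?_ ?_
    · rintro z hz (hzK | hzγ)
      · exact componentsIn.subset hG hz hzK
      · exact hne (h.eq_arcFace hG hz hzγ)
    · intro z hz
      rw [eq_connectedComponentIn hG hz]
      exact connectedComponentIn_mono _ hsub
  apply Subset.antisymm
  · intro F hF
    obtain ⟨z, hz⟩ := componentsIn.nonempty hF
    have hzW := componentsIn.subset hF hz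
    have hG := connectedComponentIn_mem_componentsIn (hsub hzW)
    by_cases hGe : connectedComponentIn Kᶜ z = arcFace K γ
    · right
      refine ⟨hF, ?_⟩
      rw [← hGe, eq_connectedComponentIn hF hz]
      exact connectedComponentIn_mono _ hsub
    · left
      have := componentsIn.eq_of_mem hF (hmem _ ⟨hG, hGe⟩) hz (mem_connectedComponentIn (hsub hzW))
      rw [this]
      exact ⟨hG, hGe⟩
  · rintro F (hF | hF)
    exacts [hmem F hF, hF.1]

lemma disjoint_arcParts : Disjoint (componentsIn Kᶜ \ {arcFace K γ}) (arcParts K γ) := by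
  rw [Set.disjoint_left]
  rintro F ⟨hF, hne⟩ hF'
  obtain ⟨z, hz⟩ := componentsIn.nonempty hF
  exact hne (componentsIn.eq_of_mem hF h.arcFace_mem hz (hF'.2 hz))

lemma mem_arcParts_of_mem_closure {F : Set ℂ} (hF : F ∈ componentsIn (K ∪ range γ)ᶜ) {y : ℂ}
    (hy : y ∈ range γ \ {u, v}) (hyF : y ∈ closure F) : F ∈ arcParts K γ := by
  obtain ⟨z, hz, hzF⟩ := mem_closure_iff.mp hyF _ h.isOpen_arcFace (h.diff_subset_arcFace hy)
  rw [h.componentsIn_eq] at hF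
  rcases hF with hF | hF
  · exact absurd (componentsIn.eq_of_mem hF.1 h.arcFace_mem hzF hz) hF.2
  · exact hF

lemma eq_or_eq_or_eq_of_mem_arcParts {F₁ F₂ F₃ : Set ℂ} (h₁ : F₁ ∈ arcParts K γ)
    (h₂ : F₂ ∈ arcParts K γ) (h₃ : F₃ ∈ arcParts K γ) : F₁ = F₂ ∨ F₃ = F₂ ∨ F₁ = F₃ := by
  obtain ⟨a, ha⟩ := componentsIn.nonempty h₁.1
  obtain ⟨b, hb⟩ := componentsIn.nonempty h₂.1
  obtain ⟨c, hc⟩ := componentsIn.nonempty h₃.1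
  rw [eq_connectedComponentIn h₁.1 ha, eq_connectedComponentIn h₂.1 hb,
    eq_connectedComponentIn h₃.1 hc]
  exact connectedComponentIn_eq_or_eq_or_eq h.injective h.isCompact h.left_mem h.right_mem
    h.inter_subset h.isOpen_arcFace (componentsIn.isPreconnected h.arcFace_mem)
    (componentsIn.subset h.arcFace_mem) (subset_diff_of_mem_arcParts h₁ ha) (subset_diff_of_mem_arcParts h₂ hb)
    (subset_diff_of_mem_arcParts h₃ hc)

lemma arcParts_subset_pair : ∃ F₁ F₂, arcParts K γ ⊆ {F₁, F₂} := by
  obtain ⟨F₁, h₁⟩ := h.arcParts_nonempty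
  by_cases hall : ∀ F ∈ arcParts K γ, F = F₁
  · exact ⟨F₁, F₁, fun F hF => Or.inl (hall F hF)⟩
  · push Not at hall
    obtain ⟨F₂, h₂, hne⟩ := hall
    refine ⟨F₁, F₂, fun F hF => ?_⟩
    rcases h.eq_or_eq_or_eq_of_mem_arcParts hF h₁ h₂ with h' | h' | h'
    exacts [Or.inl h', absurd h' hne, Or.inr h']

lemma finite_arcParts : (arcParts K γ).Finite :=
  let ⟨_, _, hs⟩ := h.arcParts_subset_pair
  (toFinite _).subset hs

lemma ncard_arcParts_le : (arcParts K γ).ncard ≤ 2 := by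
  obtain ⟨F₁, F₂, hs⟩ := h.arcParts_subset_pair
  exact (ncard_le_ncard hs (toFinite _)).trans ((ncard_insert_le F₁ {F₂}).trans (by simp))

lemma finite_componentsIn (hfin : (componentsIn Kᶜ).Finite) :
    (componentsIn (K ∪ range γ)ᶜ).Finite := by
  rw [h.componentsIn_eq]
  exact hfin.sdiff.union h.finite_arcParts

lemma ncard_componentsIn (hfin : (componentsIn Kᶜ).Finite) :
    (componentsIn (K ∪ range γ)ᶜ).ncard + 1 =
      (componentsIn Kᶜ).ncard + (arcParts K γ).ncard := by
  rw [h.componentsIn_eq, ncard_union_eq h.disjoint_arcParts hfin.sdiff h.finite_arcParts]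
  have := ncard_sdiff_singleton_add_one h.arcFace_mem hfin
  omega

lemma two_le_ncard_arcParts (hj : JoinedIn K u v) : 2 ≤ (arcParts K γ).ncard := by
  obtain ⟨a, ha, b, hb, hne⟩ := exists_connectedComponentIn_ne (Path.ne_of_injective h.injective)
    isCompact_range_path.isClosed h.arcFace_mem h.isCompact.isClosed hj
    ⟨γ, fun t => ⟨t, rfl⟩⟩ h.diff_subset_arcFace rfl
  rw [← ncard_pair hne]
  refine ncard_le_ncard ?_ h.finite_arcParts
  rintro _ (rfl | rfl)
  exacts [h.connectedComponentIn_mem_arcParts ha, h.connectedComponentIn_mem_arcParts hb]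

lemma ncard_arcParts_of_joinedIn (hj : JoinedIn K u v) : (arcParts K γ).ncard = 2 :=
  le_antisymm h.ncard_arcParts_le (h.two_le_ncard_arcParts hj)

lemma arcParts_eq_of_separated {K₁ K₂ : Set ℂ} (hK : K = K₁ ∪ K₂) (hK₁ : IsCompact K₁)
    (hK₂ : IsCompact K₂) (hd : Disjoint K₁ K₂) (hu : u ∈ K₁) (hv : v ∈ K₂) :
    arcParts K γ = {arcFace K γ \ range γ} := by
  obtain ⟨F₁, h₁⟩ := h.arcParts_nonempty
  obtain ⟨a, ha⟩ := componentsIn.nonempty h₁.1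
  have key : ∀ b ∈ arcFace K γ \ range γ, F₁ = connectedComponentIn (K ∪ range γ)ᶜ b := by
    intro b hb
    have hFK := componentsIn.subset h.arcFace_mem
    have hin := h.inter_subset
    rw [eq_connectedComponentIn h₁.1 ha]
    subst hK
    exact connectedComponentIn_eq_of_separated h.injective hK₁ hK₂ hd hu hv hin
      h.isOpen_arcFace (componentsIn.isPreconnected h.arcFace_mem) hFK
      (subset_diff_of_mem_arcParts h₁ ha) hb
  have heq : F₁ = arcFace K γ \ range γ := by
    refine (subset_diff_of_mem_arcParts h₁).antisymm fun b hb => ?_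
    rw [key b hb]
    exact mem_connectedComponentIn fun h' =>
      h'.elim (componentsIn.subset h.arcFace_mem hb.1) hb.2
  rw [← heq]
  refine Subset.antisymm ?_ (singleton_subset_iff.mpr h₁)
  intro F hF
  obtain ⟨b, hb⟩ := componentsIn.nonempty hF.1
  rw [mem_singleton_iff, key b (subset_diff_of_mem_arcParts hF hb)]
  exact eq_connectedComponentIn hF.1 hb

/-- An arc has empty interior, so it cannot fill a neighborhood of one of its points. -/
lemma range_subset_closure_diff : range γ \ {u, v} ⊆ closure (arcFace K γ \ range γ) := by
  intro y hy
  rw [mem_closure_iff]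
  intro O hO hyO
  by_contra hne
  have hsub : O ∩ arcFace K γ ⊆ range γ := by
    intro z hz
    by_contra hzγ
    exact hne ⟨z, hz.1, hz.2, hzγ⟩
  have := (hO.inter h.isOpen_arcFace).subset_interior_iff.mpr hsub
  rw [interior_range_arc h.injective] at this
  exact this ⟨hyO, h.diff_subset_arcFace hy⟩

/-- If a point of the arc is off `closure F`, so is a short subarc `A` around it. Move the rest of
the arc into `K`: the ends of `A` are then still joined, through `u` and `v`, so `A` alone cuts its
face `F'` in two. There are at most two parts, so `F` is one of the pieces inside `F'`. -/
lemma diff_subset_closure_of_joinedIn (hj : JoinedIn K u v) {F : Set ℂ}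
    (hF : F ∈ arcParts K γ) : range γ \ {u, v} ⊆ closure F := by
  rw [Path.range_diff_eq_image_extend h.injective]
  rintro _ ⟨t, ht, rfl⟩
  by_contra htF
  set c := γ.extend
  have hc : Continuous c := γ.continuous_extend
  have hinj : InjOn c (Icc 0 1) := Path.injOn_extend h.injective
  have hc0 : c 0 = u := by simp [c]
  have hc1 : c 1 = v := by simp [c]
  have hopen : IsOpen (Ioo 0 1 ∩ c ⁻¹' (closure F)ᶜ) :=
    isOpen_Ioo.inter (isClosed_closure.isOpen_compl.preimage hc)
  obtain ⟨ε, hε, hball⟩ := Metric.isOpen_iff.mp hopen t ⟨ht, htF⟩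
  have hIcc : Icc (t - ε / 2) (t + ε / 2) ⊆ Ioo 0 1 ∩ c ⁻¹' (closure F)ᶜ := by
    intro s hs
    refine hball ?_
    rw [Metric.mem_ball, Real.dist_eq, abs_lt]
    constructor <;> linarith [hs.1, hs.2]
  set t₁ := t - ε / 2
  set t₂ := t + ε / 2
  have h12 : t₁ < t ∧ t < t₂ := by constructor <;> simp only [t₁, t₂] <;> linarith
  have ht₁ := (hIcc ⟨le_rfl, by linarith⟩).1
  have ht₂ := (hIcc ⟨by linarith, le_rfl⟩).1
  have hpath : ∀ a b : ℝ, a ≤ b → JoinedIn (c '' Icc a b) (c a) (c b) := by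
    intro a b hab
    have : IsPathConnected (c '' Icc a b) :=
      ((convex_Icc a b).isPathConnected ⟨a, by simp [hab]⟩).image hc
    exact this.joinedIn _ ⟨a, by simp [hab], rfl⟩ _ ⟨b, by simp [hab], rfl⟩
  set A := c '' Icc t₁ t₂
  set K' := K ∪ (c '' Icc 0 t₁ ∪ c '' Icc t₂ 1)
  have hA : IsCompact A := isCompact_Icc.image hc
  have hK' : IsCompact K' :=
    h.isCompact.union ((isCompact_Icc.image hc).union (isCompact_Icc.image hc))
  have hKA : K' ∪ A = K ∪ range γ := by
    have hI : (Icc 0 1 : Set ℝ) = Icc 0 t₁ ∪ Icc t₂ 1 ∪ Icc t₁ t₂ := by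
      ext s
      simp only [mem_union, mem_Icc]
      constructor
      · rintro ⟨h0, h1⟩
        rcases le_total s t₁ with h2 | h2
        · exact Or.inl (Or.inl ⟨h0, h2⟩)
        · rcases le_total s t₂ with h3 | h3
          · exact Or.inr ⟨h2, h3⟩
          · exact Or.inl (Or.inr ⟨h3, h1⟩)
      · rintro ((⟨h0, h1⟩ | ⟨h0, h1⟩) | ⟨h0, h1⟩) <;>
          constructor <;> linarith [ht₁.1, ht₁.2, ht₂.1, ht₂.2]
    rw [Path.range_eq_image_extend, hI, image_union, image_union, ← union_assoc]
  have hKK' : K ⊆ K' := subset_union_left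
  have hjoin : JoinedIn K' (c t₁) (c t₂) := by
    have h1 := ((hpath 0 t₁ ht₁.1.le).symm).mono
      (subset_union_left.trans subset_union_right : c '' Icc 0 t₁ ⊆ K')
    have h2 := ((hpath t₂ 1 ht₂.2.le).symm).mono
      (subset_union_right.trans subset_union_right : c '' Icc t₂ 1 ⊆ K')
    rw [hc0] at h1
    rw [hc1] at h2
    exact (h1.trans (hj.mono hKK')).trans h2
  have hout : c '' Ioo t₁ t₂ ⊆ K'ᶜ := by
    rintro _ ⟨s, hs, rfl⟩ hsK
    have hsI : s ∈ Ioo (0 : ℝ) 1 := (hIcc (Ioo_subset_Icc_self hs)).1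
    rcases hsK with hsK | ⟨r, hr, hrs⟩ | ⟨r, hr, hrs⟩
    · exact h.image_extend_subset ⟨s, hsI, rfl⟩ hsK
    · have := hinj ⟨hr.1, hr.2.trans ht₁.2.le⟩ (Ioo_subset_Icc_self hsI) hrs
      linarith [hs.1, hr.2]
    · have := hinj ⟨ht₂.1.le.trans hr.1, hr.2⟩ (Ioo_subset_Icc_self hsI) hrs
      linarith [hs.2, hr.1]
  have htmem : c t ∈ c '' Ioo t₁ t₂ := ⟨t, h12, rfl⟩
  set F' := connectedComponentIn K'ᶜ (c t)
  have hF' : F' ∈ componentsIn K'ᶜ := connectedComponentIn_mem_componentsIn (hout htmem)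
  have hIooF' : c '' Ioo t₁ t₂ ⊆ F' :=
    (isPreconnected_Ioo.image _ hc.continuousOn).subset_connectedComponentIn htmem hout
  have hAF' : A \ {c t₁, c t₂} ⊆ F' := by
    rintro _ ⟨⟨s, hs, rfl⟩, hne⟩
    refine hIooF' ⟨s, ⟨lt_of_le_of_ne hs.1 ?_, lt_of_le_of_ne hs.2 ?_⟩, rfl⟩
    · rintro rfl; exact hne (Or.inl rfl)
    · rintro rfl; exact hne (Or.inr rfl)
  have hne : c t₁ ≠ c t₂ := by
    intro he
    have := hinj (Ioo_subset_Icc_self ht₁) (Ioo_subset_Icc_self ht₂) he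
    linarith [h12.1, h12.2]
  have hctF : c t ∈ arcFace K γ := by
    refine h.diff_subset_arcFace ?_
    rw [Path.range_diff_eq_image_extend h.injective]
    exact ⟨t, ht, rfl⟩
  have hF'F : F' ⊆ arcFace K γ := by
    rw [eq_connectedComponentIn h.arcFace_mem hctF]
    exact connectedComponentIn_mono _ (compl_subset_compl.mpr hKK')
  obtain ⟨a, ha, b, hb, hab⟩ := exists_connectedComponentIn_ne hne hA.isClosed hF' hK'.isClosed
    hjoin (hpath _ _ (by linarith)) hAF' hKA
  have hmemdiff : ∀ x ∈ F' \ A, x ∈ arcFace K γ \ range γ := by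
    intro x hx
    refine ⟨hF'F hx.1, fun hxγ => ?_⟩
    have : x ∈ K' ∪ A := by rw [hKA]; exact Or.inr hxγ
    exact this.elim (componentsIn.subset hF' hx.1) hx.2
  have hcompsub : ∀ x ∈ F' \ A, connectedComponentIn (K ∪ range γ)ᶜ x ⊆ F' := by
    intro x hx
    rw [eq_connectedComponentIn hF' hx.1, ← hKA]
    exact connectedComponentIn_mono _ (compl_subset_compl.mpr subset_union_left)
  have hFF' : F ⊆ F' := by
    rcases h.eq_or_eq_or_eq_of_mem_arcParts
      (h.connectedComponentIn_mem_arcParts (hmemdiff a ha)) hF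
      (h.connectedComponentIn_mem_arcParts (hmemdiff b hb)) with h' | h' | h'
    · rw [← h']; exact hcompsub a ha
    · rw [← h']; exact hcompsub b hb
    · exact absurd h' hab
  -- `F'` avoids `K'` and `A` avoids `closure F`, so `F` is relatively closed as well as open in the
  -- connected set `F'`. Then `F` would contain the chosen point of the arc.
  have hsubF : F' ⊆ F := by
    have hFne := componentsIn.nonempty hF.1
    refine (componentsIn.isPreconnected hF').subset_of_closure_inter_subset
      (componentsIn.isOpen hF.1 h.isCompact_union.isClosed.isOpen_compl) ?_ ?_
    · rwa [inter_eq_self_of_subset_right hFF']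
    · rintro x ⟨hxF, hxF'⟩
      refine componentsIn.closure_inter_subset hF.1 ⟨hxF, ?_⟩
      rw [← hKA]
      rintro (hxK | ⟨s, hs, rfl⟩)
      · exact componentsIn.subset hF' hxF' hxK
      · exact (hIcc hs).2 hxF
  exact htF (subset_closure (hsubF (hIooF' htmem)))

lemma range_subset_closure : range γ ⊆ closure (range γ \ {u, v}) := by
  rw [Path.range_diff_eq_image_extend h.injective, Path.range_eq_image_extend]
  rw [← closure_Ioo (zero_ne_one (α := ℝ))]
  exact image_closure_subset_closure_image γ.continuous_extend

end IsAttached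

end Arc

/-! ### Graph components under deletion of an edge -/

namespace SimpleGraph

variable {V : Type*} {G : SimpleGraph V} {u v : V}

lemma card_connectedComponent_bot :
    Nat.card (⊥ : SimpleGraph V).ConnectedComponent = Nat.card V := by
  refine (Nat.card_eq_of_bijective (⊥ : SimpleGraph V).connectedComponentMk
    ⟨fun a b hab => ?_, fun c => ?_⟩).symm
  · simpa using ConnectedComponent.exact hab
  · induction c using ConnectedComponent.ind with
    | _ w => exact ⟨w, rfl⟩

section DeleteEdge

open Classical in
/-- Deleting the edge `uv` and identifying the component of `v` with that of `u` gives back the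
components of the graph. -/
noncomputable def mergeComponent (G : SimpleGraph V) (u v w : V) :
    (G.deleteEdges {s(u, v)}).ConnectedComponent :=
  if (G.deleteEdges {s(u, v)}).connectedComponentMk w =
      (G.deleteEdges {s(u, v)}).connectedComponentMk v
    then (G.deleteEdges {s(u, v)}).connectedComponentMk u
    else (G.deleteEdges {s(u, v)}).connectedComponentMk w

lemma mergeComponent_eq_of_reachable {a b : V} (h : G.Reachable a b) :
    G.mergeComponent u v a = G.mergeComponent u v b := by
  obtain ⟨p⟩ := h
  induction p with
  | nil => rfl
  | @cons a b c hab p ih =>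
    rw [← ih]
    by_cases he : s(a, b) = s(u, v)
    · rcases Sym2.eq_iff.mp he with ⟨rfl, rfl⟩ | ⟨rfl, rfl⟩ <;> simp [mergeComponent]
    · have hadj : (G.deleteEdges {s(u, v)}).Adj a b := by
        rw [deleteEdges_adj]; exact ⟨hab, he⟩
      have : (G.deleteEdges {s(u, v)}).connectedComponentMk a =
          (G.deleteEdges {s(u, v)}).connectedComponentMk b :=
        ConnectedComponent.sound hadj.reachable
      rw [mergeComponent, mergeComponent, this]

lemma reachable_of_mergeComponent_eq (h : G.Adj u v) {a b : V}
    (hab : G.mergeComponent u v a = G.mergeComponent u v b) : G.Reachable a b := by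
  have key : ∀ w, ∃ x, (G.deleteEdges {s(u, v)}).connectedComponentMk x =
      G.mergeComponent u v w ∧ G.Reachable w x := by
    intro w
    by_cases hw : (G.deleteEdges {s(u, v)}).connectedComponentMk w =
      (G.deleteEdges {s(u, v)}).connectedComponentMk v
    · refine ⟨u, by simp [mergeComponent, hw], ?_⟩
      exact ((ConnectedComponent.exact hw).mono (deleteEdges_le _)).trans h.symm.reachable
    · exact ⟨w, by simp [mergeComponent, hw], Reachable.refl _⟩
  obtain ⟨x, hx, hax⟩ := key a
  obtain ⟨y, hy, hby⟩ := key b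
  rw [hab, ← hy] at hx
  exact (hax.trans ((ConnectedComponent.exact hx).mono (deleteEdges_le _))).trans hby.symm

/-- The map on components induced by `mergeComponent`. -/
noncomputable def componentMerge (G : SimpleGraph V) (u v : V) :
    G.ConnectedComponent → (G.deleteEdges {s(u, v)}).ConnectedComponent :=
  ConnectedComponent.lift (G.mergeComponent u v)
    fun _ _ p _ => mergeComponent_eq_of_reachable p.reachable

lemma componentMerge_mk (w : V) :
    G.componentMerge u v (G.connectedComponentMk w) = G.mergeComponent u v w := rfl

lemma componentMerge_injective (h : G.Adj u v) : Function.Injective (G.componentMerge u v) := by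
  intro c d
  refine ConnectedComponent.ind₂ (fun a b hab => ?_) c d
  exact ConnectedComponent.sound (reachable_of_mergeComponent_eq h hab)

lemma card_connectedComponent_deleteEdges_of_reachable (h : G.Adj u v)
    (hr : (G.deleteEdges {s(u, v)}).Reachable u v) :
    Nat.card (G.deleteEdges {s(u, v)}).ConnectedComponent = Nat.card G.ConnectedComponent := by
  refine (Nat.card_eq_of_bijective _ ⟨componentMerge_injective h, fun c => ?_⟩).symm
  induction c using ConnectedComponent.ind with
  | _ w =>
    refine ⟨G.connectedComponentMk w, ?_⟩
    rw [componentMerge_mk, mergeComponent]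
    split_ifs with hw
    · rw [hw]; exact ConnectedComponent.sound hr
    · rfl

/-- The injection `componentMerge` sends the component of the deleted edge to the side of `u`, so it
misses exactly the side of `v`. -/
lemma card_connectedComponent_deleteEdges_of_not_reachable [Finite V] (h : G.Adj u v)
    (hr : ¬ (G.deleteEdges {s(u, v)}).Reachable u v) :
    Nat.card (G.deleteEdges {s(u, v)}).ConnectedComponent =
      Nat.card G.ConnectedComponent + 1 := by
  have hrange : range (G.componentMerge u v) =
      {(G.deleteEdges {s(u, v)}).connectedComponentMk v}ᶜ := by
    ext c
    induction c using ConnectedComponent.ind with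
    | _ w =>
      constructor
      · rintro ⟨d, hd⟩ hw
        induction d using ConnectedComponent.ind with
        | _ x =>
          rw [hw, componentMerge_mk, mergeComponent] at hd
          split_ifs at hd with hx
          · exact hr (ConnectedComponent.exact hd)
          · exact hx hd
      · intro hw
        refine ⟨G.connectedComponentMk w, ?_⟩
        rw [componentMerge_mk, mergeComponent]
        exact if_neg hw
  have h1 : Nat.card G.ConnectedComponent = (range (G.componentMerge u v)).ncard := by
    rw [← Nat.card_coe_set_eq]
    exact Nat.card_congr (Equiv.ofInjective _ (componentMerge_injective h))
  rw [h1, hrange]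
  have := Set.ncard_add_ncard_compl
    {(G.deleteEdges {s(u, v)}).connectedComponentMk v}
  rw [Set.ncard_singleton] at this
  omega

end DeleteEdge

end SimpleGraph

/-! ### Plane drawings and Euler's formula -/

namespace PlaneDrawing

variable {V : Type*} {G H : SimpleGraph V} (D : PlaneDrawing G)

/-- The drawing of a spanning subgraph. -/
def restrict (hle : H ≤ G) : PlaneDrawing H where
  point := D.point
  point_injective := D.point_injective
  arc e := D.arc ⟨e, SimpleGraph.edgeSet_mono hle e.2⟩
  arc_isArc _ _ h := D.arc_isArc _ _ (hle h)
  mem_of_point_mem_arc _ v h := D.mem_of_point_mem_arc _ v h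
  arc_inter_arc _ _ hne := D.arc_inter_arc _ _ fun h =>
    hne (Subtype.ext (Subtype.mk.inj h))

lemma isCompact_arc (e : G.edgeSet) : IsCompact (D.arc e) := by
  obtain ⟨⟨u, v⟩, h⟩ := e
  obtain ⟨γ, -, hγ⟩ := D.arc_isArc u v h
  exact hγ ▸ isCompact_range_path

lemma point_mem_arc (e : G.edgeSet) {v : V} (hv : v ∈ (e : Sym2 V)) : D.point v ∈ D.arc e := by
  obtain ⟨⟨a, b⟩, h⟩ := e
  obtain ⟨γ, -, hγ⟩ := D.arc_isArc a b h
  have : D.point v ∈ range γ := by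
    rcases Sym2.mem_iff.mp hv with rfl | rfl
    exacts [⟨0, by simp⟩, ⟨1, by simp⟩]
  rw [hγ] at this
  exact this

lemma point_mem_support (v : V) : D.point v ∈ D.support := Or.inl ⟨v, rfl⟩

lemma arc_subset_support (e : G.edgeSet) : D.arc e ⊆ D.support :=
  (subset_iUnion D.arc e).trans subset_union_right

lemma support_restrict_subset (hle : H ≤ G) : (D.restrict hle).support ⊆ D.support := by
  rintro z (hz | hz)
  · exact Or.inl hz
  · obtain ⟨e, he⟩ := mem_iUnion.mp hz
    exact D.arc_subset_support _ he

lemma isCompact_support [Finite V] : IsCompact D.support :=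
  (finite_range D.point).isCompact.union (isCompact_iUnion D.isCompact_arc)

lemma isOpen_compl_support [Finite V] : IsOpen D.supportᶜ :=
  D.isCompact_support.isClosed.isOpen_compl

lemma faces_eq : D.faces = componentsIn D.supportᶜ := rfl

section DeleteEdge

variable {u v : V}

/-- The drawing without the edge `uv`. -/
abbrev deleteEdge (u v : V) : PlaneDrawing (G.deleteEdges {s(u, v)}) :=
  D.restrict (G.deleteEdges_le _)

lemma support_eq_union_arc (h : G.Adj u v) :
    D.support = (D.deleteEdge u v).support ∪ D.arc ⟨s(u, v), h⟩ := by
  apply Subset.antisymm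
  · rintro z (hz | hz)
    · exact Or.inl (Or.inl hz)
    · obtain ⟨e, he⟩ := mem_iUnion.mp hz
      by_cases hee : (e : Sym2 V) = s(u, v)
      · right
        have : e = ⟨s(u, v), h⟩ := Subtype.ext hee
        rwa [← this]
      · left
        have he' : (e : Sym2 V) ∈ (G.deleteEdges {s(u, v)}).edgeSet := by
          rw [SimpleGraph.edgeSet_deleteEdges]; exact ⟨e.2, hee⟩
        exact (D.deleteEdge u v).arc_subset_support ⟨e, he'⟩ he
  · exact union_subset (D.support_restrict_subset _) (D.arc_subset_support _)

lemma isAttached [Finite V] (h : G.Adj u v) {γ : Path (D.point u) (D.point v)}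
    (hγ : Function.Injective γ) (hr : range γ = D.arc ⟨s(u, v), h⟩) :
    IsAttached (D.deleteEdge u v).support γ where
  injective := hγ
  isCompact := isCompact_support _
  left_mem := (D.deleteEdge u v).point_mem_support u
  right_mem := (D.deleteEdge u v).point_mem_support v
  inter_subset := by
    rw [hr]
    have key : ∀ z ∈ D.arc ⟨s(u, v), h⟩, z ∈ range D.point → z ∈ ({D.point u, D.point v} : Set ℂ) := by
      rintro _ hz ⟨w, rfl⟩
      rcases Sym2.mem_iff.mp (D.mem_of_point_mem_arc _ w hz) with rfl | rfl
      exacts [Or.inl rfl, Or.inr rfl]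
    rintro z ⟨hz | hz, hz'⟩
    · exact key z hz' hz
    · obtain ⟨e, he⟩ := mem_iUnion.mp hz
      refine key z hz' (D.arc_inter_arc _ _ (fun hee => ?_) ⟨he, hz'⟩)
      have he2 : (e : Sym2 V) ∈ G.edgeSet \ {s(u, v)} := by
        rw [← SimpleGraph.edgeSet_deleteEdges]; exact e.2
      exact he2.2 (Subtype.mk.inj hee)

lemma joinedIn_support {a b : V} (h : G.Reachable a b) :
    JoinedIn D.support (D.point a) (D.point b) := by
  obtain ⟨p⟩ := h
  induction p with
  | nil => exact JoinedIn.refl (D.point_mem_support _)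
  | @cons a b c hab p ih =>
    obtain ⟨γ, -, hγ⟩ := D.arc_isArc a b hab
    refine JoinedIn.trans ⟨γ, fun t => D.arc_subset_support ⟨s(a, b), hab⟩ ?_⟩ ih
    rw [← hγ]
    exact ⟨t, rfl⟩

/-- The part of the drawing formed by the vertices and edges meeting a set of vertices. -/
def supportOn (S : Set V) : Set ℂ :=
  D.point '' S ∪ ⋃ e : {e : G.edgeSet // ∃ w ∈ S, w ∈ (e : Sym2 V)}, D.arc e

lemma isCompact_supportOn [Finite V] (S : Set V) : IsCompact (D.supportOn S) :=
  ((toFinite S).image D.point).isCompact.union (isCompact_iUnion fun e => D.isCompact_arc e)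

lemma support_eq_supportOn_union (S : Set V) :
    D.support = D.supportOn S ∪ D.supportOn Sᶜ := by
  apply Subset.antisymm
  · rintro z (⟨w, rfl⟩ | hz)
    · by_cases hw : w ∈ S
      · exact Or.inl (Or.inl ⟨w, hw, rfl⟩)
      · exact Or.inr (Or.inl ⟨w, hw, rfl⟩)
    · obtain ⟨e, he⟩ := mem_iUnion.mp hz
      obtain ⟨w, hw⟩ : ∃ w, w ∈ (e : Sym2 V) := ⟨_, Sym2.out_fst_mem _⟩
      by_cases hwS : w ∈ S
      · exact Or.inl (Or.inr (mem_iUnion.mpr ⟨⟨e, w, hwS, hw⟩, he⟩))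
      · exact Or.inr (Or.inr (mem_iUnion.mpr ⟨⟨e, w, hwS, hw⟩, he⟩))
  · have : ∀ T, D.supportOn T ⊆ D.support := by
      rintro T z (⟨w, -, rfl⟩ | hz)
      · exact D.point_mem_support w
      · obtain ⟨e, he⟩ := mem_iUnion.mp hz
        exact D.arc_subset_support _ he
    exact union_subset (this _) (this _)

/-- Edges on different sides are different, so their arcs could meet only in a vertex, and that
vertex would be an end of both. -/
lemma disjoint_supportOn {S : Set V} (hS : ∀ a b, G.Adj a b → a ∈ S → b ∈ S) :
    Disjoint (D.supportOn S) (D.supportOn Sᶜ) := by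
  have hends : ∀ (e : G.edgeSet) (x y : V), x ∈ (e : Sym2 V) → y ∈ (e : Sym2 V) → x ∈ S →
      y ∈ S := by
    rintro ⟨⟨a, b⟩, h⟩ x y hx hy hxS
    rcases Sym2.mem_iff.mp hx with rfl | rfl <;> rcases Sym2.mem_iff.mp hy with rfl | rfl
    · exact hxS
    · exact hS _ _ h hxS
    · exact hS _ _ (G.adj_symm h) hxS
    · exact hxS
  have hpt : ∀ T : Set V, (∀ (e : G.edgeSet) (x y : V), x ∈ (e : Sym2 V) → y ∈ (e : Sym2 V) →
      x ∈ T → y ∈ T) → ∀ w, D.point w ∈ D.supportOn T → w ∈ T := by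
    rintro T hT w (⟨x, hx, hxw⟩ | hz)
    · rwa [← D.point_injective hxw]
    · obtain ⟨⟨e, x, hxT, hxe⟩, he⟩ := mem_iUnion.mp hz
      exact hT e x w hxe (D.mem_of_point_mem_arc e w he) hxT
  have hends' : ∀ (e : G.edgeSet) (x y : V), x ∈ (e : Sym2 V) → y ∈ (e : Sym2 V) → x ∈ Sᶜ →
      y ∈ Sᶜ := fun e x y hx hy hxS hyS => hxS (hends e y x hy hx hyS)
  have hno : ∀ w, D.point w ∈ D.supportOn S → D.point w ∉ D.supportOn Sᶜ := fun w h1 h2 =>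
    hpt Sᶜ hends' w h2 (hpt S hends w h1)
  rw [Set.disjoint_left]
  intro z hz hz'
  have : z ∈ range D.point := by
    rcases hz with ⟨w, -, rfl⟩ | hz1
    · exact ⟨w, rfl⟩
    · rcases hz' with ⟨w, -, rfl⟩ | hz2
      · exact ⟨w, rfl⟩
      · obtain ⟨⟨e, x, hxS, hxe⟩, he⟩ := mem_iUnion.mp hz1
        obtain ⟨⟨e', y, hyS, hye⟩, he'⟩ := mem_iUnion.mp hz2
        refine D.arc_inter_arc e e' ?_ ⟨he, he'⟩
        rintro rfl
        exact hyS (hends e x y hxe hye hxS)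
  obtain ⟨w, rfl⟩ := this
  exact hno w hz hz'

lemma arcParts_eq_of_not_reachable [Finite V] (h : G.Adj u v)
    {γ : Path (D.point u) (D.point v)}
    (hγ : Function.Injective γ) (hr : range γ = D.arc ⟨s(u, v), h⟩)
    (hn : ¬ (G.deleteEdges {s(u, v)}).Reachable u v) :
    arcParts (D.deleteEdge u v).support γ =
      {arcFace (D.deleteEdge u v).support γ \ range γ} := by
  -- Without the bridge, the component of `u` and the remaining vertices give disjoint compact parts
  -- of the drawing.
  set S : Set V := {w | (G.deleteEdges {s(u, v)}).Reachable u w}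
  refine (D.isAttached h hγ hr).arcParts_eq_of_separated
    ((D.deleteEdge u v).support_eq_supportOn_union S) (isCompact_supportOn _ S)
    (isCompact_supportOn _ Sᶜ) (disjoint_supportOn _ fun a b hab ha => ?_)
    (Or.inl ⟨u, SimpleGraph.Reachable.refl _, rfl⟩) (Or.inl ⟨v, hn, rfl⟩)
  exact SimpleGraph.Reachable.trans ha hab.reachable

lemma joinedIn_deleteEdge (hj : (G.deleteEdges {s(u, v)}).Reachable u v) :
    JoinedIn (D.deleteEdge u v).support (D.point u) (D.point v) :=
  (D.deleteEdge u v).joinedIn_support hj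

end DeleteEdge

lemma faces_eq_singleton_of_eq_bot [Finite V] (h : G = ⊥) : D.faces = {D.supportᶜ} := by
  subst h
  have hs : D.support = range D.point := by
    have : IsEmpty (⊥ : SimpleGraph V).edgeSet := by simp
    simp [support]
  have hc : IsConnected D.supportᶜ := by
    rw [hs]
    exact (countable_range D.point).isConnected_compl_of_one_lt_rank (by simp)
  apply Subset.antisymm
  · rintro F ⟨z, hz, rfl⟩
    exact hc.isPreconnected.connectedComponentIn hz
  · rintro _ rfl
    obtain ⟨z, hz⟩ := hc.nonempty
    exact ⟨z, hz, (hc.isPreconnected.connectedComponentIn hz).symm⟩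

/-- Euler's formula. -/
theorem finite_faces_and_euler [Finite V] :
    D.faces.Finite ∧ D.faces.ncard + Nat.card V =
      G.edgeSet.ncard + Nat.card G.ConnectedComponent + 1 := by
  -- Edges are removed in any order, so the formula has to count components. Finiteness is proved
  -- along with it because `ncard` of an infinite set is 0.
  induction hn : G.edgeSet.ncard generalizing G with
  | zero =>
    have hG : G = ⊥ := by
      rw [Set.ncard_eq_zero] at hn
      exact SimpleGraph.edgeSet_eq_empty.mp hn
    rw [D.faces_eq_singleton_of_eq_bot hG]
    refine ⟨finite_singleton _, ?_⟩
    subst hG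
    rw [ncard_singleton]
    rw [SimpleGraph.card_connectedComponent_bot]
    omega
  | succ n ih =>
    obtain ⟨e, he⟩ : G.edgeSet.Nonempty := by
      rw [← Set.ncard_pos]; omega
    induction e with
    | _ u v =>
      have h : G.Adj u v := he
      obtain ⟨γ, hγ, hr⟩ := D.arc_isArc u v h
      have hA := D.isAttached h hγ hr
      have hcard : (G.deleteEdges {s(u, v)}).edgeSet.ncard = n := by
        rw [SimpleGraph.edgeSet_deleteEdges]
        have := Set.ncard_sdiff_singleton_add_one he
        omega
      obtain ⟨hfin, heul⟩ := ih (D.deleteEdge u v) hcard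
      have hfaces : D.faces = componentsIn ((D.deleteEdge u v).support ∪ range γ)ᶜ := by
        rw [hr, ← D.support_eq_union_arc h]; rfl
      rw [faces_eq] at hfin heul
      rw [hfaces]
      refine ⟨hA.finite_componentsIn hfin, ?_⟩
      have hcount := hA.ncard_componentsIn hfin
      by_cases hreach : (G.deleteEdges {s(u, v)}).Reachable u v
      · rw [hA.ncard_arcParts_of_joinedIn (D.joinedIn_deleteEdge hreach)] at hcount
        rw [SimpleGraph.card_connectedComponent_deleteEdges_of_reachable h hreach] at heul
        omega
      · rw [D.arcParts_eq_of_not_reachable h hγ hr hreach, ncard_singleton] at hcount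
        rw [SimpleGraph.card_connectedComponent_deleteEdges_of_not_reachable h hreach] at heul
        omega

end PlaneDrawing

/-! ### Edge counts of forests and of triangle-free graphs with a cycle -/

namespace SimpleGraph

variable {V : Type*} {G : SimpleGraph V}

lemma IsAcyclic.ncard_edgeSet_add_card_connectedComponent [Finite V] (h : G.IsAcyclic) :
    G.edgeSet.ncard + Nat.card G.ConnectedComponent = Nat.card V := by
  induction hn : G.edgeSet.ncard generalizing G with
  | zero =>
    rw [Set.ncard_eq_zero] at hn
    obtain rfl := edgeSet_eq_empty.mp hn
    rw [card_connectedComponent_bot, zero_add]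
  | succ n ih =>
    obtain ⟨e, he⟩ : G.edgeSet.Nonempty := by
      rw [← Set.ncard_pos]; omega
    induction e with
    | _ u v =>
      have hcard : (G.deleteEdges {s(u, v)}).edgeSet.ncard = n := by
        rw [edgeSet_deleteEdges]
        have := Set.ncard_sdiff_singleton_add_one he
        omega
      have h1 := ih (h.anti (deleteEdges_le _)) hcard
      rw [card_connectedComponent_deleteEdges_of_not_reachable he
        (isAcyclic_iff_forall_isBridge.mp h he)] at h1
      omega

lemma Connected.natCard_connectedComponent (h : G.Connected) :
    Nat.card G.ConnectedComponent = 1 := by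
  have := h.preconnected.subsingleton_connectedComponent
  have := h.nonempty
  exact Nat.card_eq_one_iff_unique.mpr ⟨inferInstance, ⟨G.connectedComponentMk (Classical.arbitrary V)⟩⟩

lemma four_le_ncard_edgeSet_of_not_isAcyclic [Finite V] {H : SimpleGraph V} (hle : H ≤ G)
    (htri : G.CliqueFree 3) (h : ¬ H.IsAcyclic) : 4 ≤ H.edgeSet.ncard := by
  classical
  obtain ⟨u, p, hp⟩ : ∃ (u : V) (p : H.Walk u u), p.IsCycle := by
    simpa [IsAcyclic] using h
  have h3 := hp.three_le_length
  have hne : p.length ≠ 3 := fun h => by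
    obtain ⟨s, hs⟩ := is3Clique_iff_exists_cycle_length_three.mpr ⟨u, p, hp, h⟩
    exact htri s (hs.mono hle)
  have h4 : p.edges.toFinset.card = p.length := by
    rw [List.toFinset_card_of_nodup hp.edges_nodup, Walk.length_edges]
  have h5 : (p.edges.toFinset : Set (Sym2 V)) ⊆ H.edgeSet := fun e he =>
    p.edges_subset_edgeSet (by simpa using he)
  have h6 := Set.ncard_le_ncard h5
  rw [Set.ncard_coe_finset] at h6
  omega

end SimpleGraph

/-- Double counting. -/
lemma Finset.sum_ncard_setOf_eq {α β : Type*} [Fintype β] (S : Finset α) (r : α → β → Prop) :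
    ∑ a ∈ S, {b | r a b}.ncard = ∑ b, {a ∈ (S : Set α) | r a b}.ncard := by
  classical
  have h := Finset.sum_card_bipartiteAbove_eq_sum_card_bipartiteBelow r (s := S)
    (t := Finset.univ)
  convert h using 2 with a _ b _
  · rw [← Set.ncard_coe_finset]; congr 1; ext b; simp [Finset.bipartiteAbove]
  · rw [← Set.ncard_coe_finset]; congr 1; ext b; simp [Finset.bipartiteBelow]

/-! ### Incidence of edges and faces, and face lengths -/

namespace PlaneDrawing

variable {V : Type*} {G H : SimpleGraph V} (D : PlaneDrawing G) {F : Set ℂ}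

lemma finite_faces [Finite V] : D.faces.Finite := D.finite_faces_and_euler.1

lemma euler [Finite V] : D.faces.ncard + Nat.card V =
    G.edgeSet.ncard + Nat.card G.ConnectedComponent + 1 := D.finite_faces_and_euler.2

lemma faces_nonempty [Finite V] : D.faces.Nonempty := by
  obtain ⟨R, hR⟩ := D.isCompact_support.isBounded.subset_closedBall 0
  refine ⟨_, ((|R| + 1 : ℝ) : ℂ), fun h => ?_, rfl⟩
  have := hR h
  rw [mem_closedBall_zero_iff, Complex.norm_real, Real.norm_eq_abs,
    abs_of_pos (by positivity)] at this
  linarith [le_abs_self R]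

variable {D}

lemma isOpen_of_mem_faces [Finite V] (hF : F ∈ D.faces) : IsOpen F :=
  componentsIn.isOpen hF D.isOpen_compl_support

section Edge

variable {u v : V} (h : G.Adj u v) {γ : Path (D.point u) (D.point v)}

lemma faces_eq_of_adj (hr : range γ = D.arc ⟨s(u, v), h⟩) :
    D.faces = componentsIn ((D.deleteEdge u v).support ∪ range γ)ᶜ := by
  rw [hr, ← D.support_eq_union_arc h]; rfl

lemma range_subset_closure [Finite V] (hγ : Function.Injective γ)
    (hr : range γ = D.arc ⟨s(u, v), h⟩) (hF : F ∈ arcParts (D.deleteEdge u v).support γ) :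
    range γ ⊆ closure F := by
  have hA := D.isAttached h hγ hr
  suffices range γ \ {D.point u, D.point v} ⊆ closure F from
    hA.range_subset_closure.trans (closure_minimal this isClosed_closure)
  by_cases hreach : (G.deleteEdges {s(u, v)}).Reachable u v
  · exact hA.diff_subset_closure_of_joinedIn (D.joinedIn_deleteEdge hreach) hF
  · rw [D.arcParts_eq_of_not_reachable h hγ hr hreach, mem_singleton_iff] at hF
    rw [hF]
    exact hA.range_subset_closure_diff

/-- A face incident with the edge comes close to the midpoint of the arc, hence meets the open face
that the arc divides. Conversely, each part has the whole arc in its closure. -/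
lemma setOf_edgeIncident_eq_arcParts [Finite V] (hγ : Function.Injective γ)
    (hr : range γ = D.arc ⟨s(u, v), h⟩) :
    {F ∈ D.faces | D.EdgeIncident ⟨s(u, v), h⟩ F} = arcParts (D.deleteEdge u v).support γ := by
  have hA := D.isAttached h hγ hr
  ext F
  constructor
  · rintro ⟨hF, hinc⟩
    rw [faces_eq_of_adj h hr] at hF
    have hmem : γ.extend (1 / 2) ∈ range γ \ {D.point u, D.point v} := by
      rw [Path.range_diff_eq_image_extend hγ]
      exact ⟨1 / 2, by norm_num, rfl⟩
    refine hA.mem_arcParts_of_mem_closure hF hmem (frontier_subset_closure (hinc ?_))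
    rw [← hr]
    exact hmem.1
  · intro hF
    have hF' : F ∈ D.faces := by rw [faces_eq_of_adj h hr]; exact hF.1
    refine ⟨hF', ?_⟩
    rw [EdgeIncident, (isOpen_of_mem_faces hF').frontier_eq, ← hr]
    intro z hz
    exact ⟨range_subset_closure h hγ hr hF hz, fun hzF => (subset_diff_of_mem_arcParts hF hzF).2 hz⟩

end Edge

/-- A non-bridge is incident with two faces, and a bridge with one. -/
lemma ncard_setOf_edgeIncident [Finite V] (e : G.edgeSet) [Decidable (G.IsBridge (e : Sym2 V))] :
    {F ∈ D.faces | D.EdgeIncident e F}.ncard =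
      if G.IsBridge (e : Sym2 V) then 1 else 2 := by
  obtain ⟨⟨u, v⟩, h⟩ := e
  obtain ⟨γ, hγ, hr⟩ := D.arc_isArc u v h
  have hA := D.isAttached h hγ hr
  refine (congr_arg ncard (setOf_edgeIncident_eq_arcParts h hγ hr)).trans ?_
  split_ifs with hb
  · rw [D.arcParts_eq_of_not_reachable h hγ hr hb, ncard_singleton]
  · exact hA.ncard_arcParts_of_joinedIn (D.joinedIn_deleteEdge (not_not.mp hb))

/-- The boundary of a face consists of vertices and whole edges. -/
lemma edgeIncident_of_mem_closure [Finite V] (hF : F ∈ D.faces) {e : G.edgeSet} {z : ℂ}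
    (hz : z ∈ D.arc e) (hzv : z ∉ range D.point) (hzF : z ∈ closure F) : D.EdgeIncident e F := by
  obtain ⟨⟨u, v⟩, h⟩ := e
  obtain ⟨γ, hγ, hr⟩ := D.arc_isArc u v h
  have hA := D.isAttached h hγ hr
  have hz' : z ∈ range γ \ {D.point u, D.point v} := by
    refine ⟨by rw [hr]; exact hz, ?_⟩
    rintro (h' | h')
    exacts [hzv ⟨u, h'.symm⟩, hzv ⟨v, h'.symm⟩]
  have hmem : F ∈ arcParts (D.deleteEdge u v).support γ :=
    hA.mem_arcParts_of_mem_closure (faces_eq_of_adj h hr ▸ hF) hz' hzF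
  rw [← setOf_edgeIncident_eq_arcParts h hγ hr] at hmem
  exact hmem.2

lemma vertexIncident_of_edgeIncident {e : G.edgeSet} (he : D.EdgeIncident e F) {w : V}
    (hw : w ∈ (e : Sym2 V)) : D.VertexIncident w F := he (D.point_mem_arc e hw)

lemma exists_mem_arc_notMem_range_point (e : G.edgeSet) : ∃ z ∈ D.arc e, z ∉ range D.point := by
  obtain ⟨⟨u, v⟩, h⟩ := e
  obtain ⟨γ, hγ, hr⟩ := D.arc_isArc u v h
  have hmem : γ.extend (1 / 2) ∈ range γ \ {D.point u, D.point v} := by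
    rw [Path.range_diff_eq_image_extend hγ]
    exact ⟨1 / 2, by norm_num, rfl⟩
  have hz : γ.extend (1 / 2) ∈ D.arc ⟨s(u, v), h⟩ := hr ▸ hmem.1
  refine ⟨_, hz, ?_⟩
  rintro ⟨w, hw⟩
  rw [← hw] at hz
  apply hmem.2
  rw [← hw]
  rcases Sym2.mem_iff.mp (D.mem_of_point_mem_arc _ w hz) with rfl | rfl
  exacts [Or.inl rfl, Or.inr rfl]

/-- A face remains a face when edges not incident with it are deleted. -/
lemma mem_faces_restrict [Finite V] (hF : F ∈ D.faces) (hle : H ≤ G)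
    (hH : ∀ e : G.edgeSet, D.EdgeIncident e F → (e : Sym2 V) ∈ H.edgeSet) :
    F ∈ (D.restrict hle).faces := by
  have hFo := isOpen_of_mem_faces hF
  refine mem_componentsIn_of_isOpen (componentsIn.nonempty hF) (componentsIn.isPreconnected hF)
    hFo ((componentsIn.subset hF).trans
      (compl_subset_compl.mpr (D.support_restrict_subset hle))) ?_
  rintro z ⟨hzF, hzH⟩
  by_contra hz
  have hzs : z ∈ D.support := by
    simpa using componentsIn.frontier_subset hF D.isOpen_compl_support
      (hFo.frontier_eq ▸ ⟨hzF, hz⟩)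
  apply hzH
  by_cases hzp : z ∈ range D.point
  · exact Or.inl hzp
  · obtain ⟨e, he⟩ := mem_iUnion.mp (hzs.resolve_left hzp)
    have heH := hH e (edgeIncident_of_mem_closure hF he hzp hzF)
    exact (D.restrict hle).arc_subset_support ⟨e, heH⟩ he

/-- If a face is the only face of a subgraph then the subgraph is the whole graph. -/
lemma eq_of_mem_faces_restrict [Finite V] (hF : F ∈ D.faces) (hle : H ≤ G)
    (hFH : F ∈ (D.restrict hle).faces) (hone : (D.restrict hle).faces.ncard ≤ 1) : H = G := by
  have hall : (D.restrict hle).supportᶜ ⊆ F := by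
    intro z hz
    have := (ncard_le_one (D.restrict hle).finite_faces).mp hone F hFH _
      (connectedComponentIn_mem_componentsIn hz)
    rw [this]
    exact mem_connectedComponentIn hz
  have hsupp : D.support ⊆ (D.restrict hle).support := by
    intro z hz
    by_contra hcon
    exact componentsIn.subset hF (hall hcon) hz
  refine le_antisymm hle fun u v h => ?_
  obtain ⟨z, hz, hzp⟩ := D.exists_mem_arc_notMem_range_point ⟨s(u, v), h⟩
  obtain ⟨e, he⟩ := mem_iUnion.mp ((hsupp (D.arc_subset_support _ hz)).resolve_left hzp)
  by_contra hcon
  refine hzp (D.arc_inter_arc _ _ (fun hee => hcon ?_) ⟨hz, he⟩)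
  have := e.2
  rw [← Subtype.mk.inj hee] at this
  exact this

/-- A non-bridge counts once for each of two faces, a bridge twice for its only face. -/
lemma sum_faceLength [Finite V] :
    ∑ F ∈ D.finite_faces.toFinset, D.faceLength F = 2 * G.edgeSet.ncard := by
  classical
  have := Fintype.ofFinite G.edgeSet
  simp only [faceLength]
  rw [Finset.sum_add_distrib, Finset.sum_ncard_setOf_eq _ (fun F e => D.EdgeIncident e F),
    Finset.sum_ncard_setOf_eq _ (fun F e => D.EdgeIncident e F ∧ G.IsBridge (e : Sym2 V)),
    ← Finset.sum_add_distrib, Finset.sum_congr rfl (g := fun _ => 2)]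
  · rw [Finset.sum_const, Finset.card_univ, ← Nat.card_eq_fintype_card, Nat.card_coe_set_eq,
      smul_eq_mul, mul_comm]
  · intro e _
    simp only [Finite.coe_toFinset]
    have h1 := D.ncard_setOf_edgeIncident e
    by_cases hb : G.IsBridge (e : Sym2 V)
    · simp only [hb, and_true, if_true] at h1 ⊢
      omega
    · simp only [hb, and_false, if_false] at h1 ⊢
      rw [h1]; simp

/-- Let `H` consist of the edges incident with `F`. A cycle in `H` has at least four edges. If `H`
is a forest, it has one face, and `F` is still a face of it, so `H = G`. Then `G` is a tree with at
least two edges, each a bridge that counts twice. -/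
lemma four_le_faceLength [Finite V] (hconn : G.Connected) (htri : G.CliqueFree 3)
    (hn : 3 ≤ Nat.card V) (hF : F ∈ D.faces) : 4 ≤ D.faceLength F := by
  set B : Set G.edgeSet := {e | D.EdgeIncident e F}
  let H : SimpleGraph V := SimpleGraph.fromEdgeSet (Subtype.val '' B)
  have hBE : Subtype.val '' B ⊆ G.edgeSet := by
    rintro _ ⟨e, -, rfl⟩; exact e.2
  have hHE : H.edgeSet = Subtype.val '' B := by
    rw [SimpleGraph.edgeSet_fromEdgeSet, sdiff_eq_left, Set.disjoint_left]
    exact fun e he => SimpleGraph.not_isDiag_of_mem_edgeSet G (hBE he)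
  have hcard : H.edgeSet.ncard = B.ncard := by
    rw [hHE, ncard_image_of_injective _ Subtype.val_injective]
  have hle : H ≤ G := by
    rw [← SimpleGraph.edgeSet_subset_edgeSet, hHE]; exact hBE
  have hlen : D.faceLength F = B.ncard + {e ∈ B | G.IsBridge (e : Sym2 V)}.ncard := rfl
  by_cases hac : H.IsAcyclic
  · have hFH : F ∈ (D.restrict hle).faces := by
      refine mem_faces_restrict hF hle fun e he => ?_
      rw [hHE]; exact ⟨e, he, rfl⟩
    have hone : (D.restrict hle).faces.ncard ≤ 1 := by
      have h1 := (D.restrict hle).euler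
      have h2 := hac.ncard_edgeSet_add_card_connectedComponent
      omega
    have hHG := eq_of_mem_faces_restrict hF hle hFH hone
    rw [hHG] at hac hcard
    have hbr : {e ∈ B | G.IsBridge (e : Sym2 V)} = B := by
      ext e
      simpa using fun _ => SimpleGraph.isAcyclic_iff_forall_isBridge.mp hac e.2
    have h2 := hac.ncard_edgeSet_add_card_connectedComponent
    rw [hconn.natCard_connectedComponent] at h2
    rw [hlen, hbr]
    omega
  · have := SimpleGraph.four_le_ncard_edgeSet_of_not_isAcyclic hle htri hac
    omega

variable (D) in
lemma sPlus_eq_sum [Finite V] :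
    D.sPlus = ∑ F ∈ D.finite_faces.toFinset, (D.faceLength F - 4) := by
  classical
  -- The condition `5 ≤ i` can be dropped because truncated subtraction makes the other terms 0.
  have h1 : ∀ i : ℕ, (∑ᶠ (_ : 5 ≤ i), (i - 4) * D.numFaces i) = (i - 4) * D.numFaces i := by
    intro i
    rw [finsum_eq_if]
    split_ifs with h
    · rfl
    · have : i - 4 = 0 := by omega
      simp [this]
  have h2 : ∀ i, D.numFaces i = {F ∈ D.finite_faces.toFinset | D.faceLength F = i}.card := by
    intro i
    rw [numFaces, ← Set.ncard_coe_finset]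
    congr 1
    ext F
    simp
  rw [sPlus, finsum_congr h1, Finset.sum_comp (fun i => i - 4) D.faceLength]
  rw [finsum_eq_sum_of_support_subset (s := D.finite_faces.toFinset.image D.faceLength)]
  · refine Finset.sum_congr rfl fun i _ => ?_
    rw [h2, smul_eq_mul, mul_comm]
  · intro i hi
    rw [Function.mem_support, h2] at hi
    obtain ⟨F, hF⟩ := Finset.card_ne_zero.mp (right_ne_zero_of_mul hi)
    rw [Finset.mem_filter] at hF
    exact Finset.mem_coe.mpr (Finset.mem_image.mpr ⟨F, hF⟩)

/-- The lower bound 4 on face lengths makes the truncated differences in `sPlus` exact. -/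
lemma sPlus_add_four_mul [Finite V] (hconn : G.Connected) (htri : G.CliqueFree 3)
    (hn : 3 ≤ Nat.card V) : D.sPlus + 4 * D.faces.ncard = 2 * G.edgeSet.ncard := by
  rw [← D.sum_faceLength, sPlus_eq_sum, ncard_eq_toFinset_card _ D.finite_faces, mul_comm,
    ← smul_eq_mul, ← Finset.sum_const, ← Finset.sum_add_distrib]
  refine Finset.sum_congr rfl fun F hF => ?_
  have := four_le_faceLength hconn htri hn ((Finite.mem_toFinset _).mp hF)
  omega

lemma sPlus_add_eight [Finite V] (hconn : G.Connected) (htri : G.CliqueFree 3)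
    (hn : 3 ≤ Nat.card V) : D.sPlus + 8 + 2 * G.edgeSet.ncard = 4 * Nat.card V := by
  have h1 := D.sPlus_add_four_mul hconn htri hn
  have h2 := D.euler
  rw [hconn.natCard_connectedComponent] at h2
  omega

end PlaneDrawing

/-! ### Kempe changes -/

namespace SimpleGraph

variable {V : Type*} {G : SimpleGraph V} (φ : G.Coloring (Fin 3)) (k : Fin 3)

/-- The spanning subgraph of the edges that avoid the color `k`. -/
def avoidColor : SimpleGraph V where
  Adj a b := G.Adj a b ∧ φ a ≠ k ∧ φ b ≠ k
  symm := ⟨fun _ _ h => ⟨h.1.symm, h.2.2, h.2.1⟩⟩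
  loopless := ⟨fun _ h => h.1.ne rfl⟩

lemma avoidColor_le : avoidColor φ k ≤ G := fun _ _ h => h.1

/-- The Kempe change for the two colors other than `k`: it interchanges them on the components
selected by `σ`. -/
def kempeChange (σ : (avoidColor φ k).ConnectedComponent → Bool) : G.Coloring (Fin 3) :=
  Coloring.mk
    -- The three colors sum to 0 in `Fin 3`, so `-(k + x)` is the third color when `x ≠ k`; it is
    -- `k` itself when `x = k`.
    (fun v => if σ ((avoidColor φ k).connectedComponentMk v) then -(k + φ v) else φ v) (by
    intro a b hab
    have hne := φ.valid hab
    have hσ : φ a ≠ k → φ b ≠ k → (avoidColor φ k).connectedComponentMk a =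
        (avoidColor φ k).connectedComponentMk b := fun ha hb =>
      ConnectedComponent.sound (Adj.reachable ⟨hab, ha, hb⟩)
    generalize (avoidColor φ k).connectedComponentMk a = c at *
    generalize (avoidColor φ k).connectedComponentMk b = d at *
    generalize φ a = x at *
    generalize φ b = y at *
    have key : ∀ (s t : Bool) (k x y : Fin 3), x ≠ y → (x ≠ k → y ≠ k → s = t) →
        (if s then -(k + x) else x) ≠ (if t then -(k + y) else y) := by decide
    exact key (σ c) (σ d) k x y hne fun h1 h2 => congr_arg σ (hσ h1 h2))

lemma kempeChange_apply (σ : (avoidColor φ k).ConnectedComponent → Bool) (v : V) :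
    kempeChange φ k σ v =
      if σ ((avoidColor φ k).connectedComponentMk v) then -(k + φ v) else φ v := rfl

instance [Finite V] : Finite (G.Coloring (Fin 3)) := DFunLike.finite _

/-- A changed coloring determines the choice on every component except the isolated vertices of
color `k`, where the change does nothing; the second factor records those choices. -/
lemma two_pow_card_connectedComponent_le [Finite V] :
    2 ^ Nat.card (avoidColor φ k).ConnectedComponent ≤
      Nat.card (G.Coloring (Fin 3)) * 2 ^ {v | φ v = k}.ncard := by
  let f : ((avoidColor φ k).ConnectedComponent → Bool) →
      G.Coloring (Fin 3) × ({v | φ v = k} → Bool) :=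
    fun σ => (kempeChange φ k σ, fun v => σ ((avoidColor φ k).connectedComponentMk v))
  have hf : Function.Injective f := by
    intro σ τ h
    obtain ⟨h1, h2⟩ := Prod.mk.inj h
    funext c
    induction c using ConnectedComponent.ind with
    | _ v =>
      by_cases hv : φ v = k
      · exact congr_fun h2 ⟨v, hv⟩
      · have h3 := DFunLike.congr_fun h1 v
        rw [kempeChange_apply, kempeChange_apply] at h3
        have key : ∀ (s t : Bool) (k x : Fin 3), x ≠ k →
          (if s then -(k + x) else x) = (if t then -(k + x) else x) → s = t := by decide
        exact key _ _ k _ hv h3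
  have := Nat.card_le_card_of_injective f hf
  rw [Nat.card_prod, Nat.card_fun, Nat.card_fun, Nat.card_coe_set_eq] at this
  simpa using this

/-- The ends of an edge have two different colors, so it avoids exactly one color. -/
lemma sum_ncard_edgeSet_avoidColor [Finite V] :
    ∑ k, (avoidColor φ k).edgeSet.ncard = G.edgeSet.ncard := by
  have hU : G.edgeSet = ⋃ k, (avoidColor φ k).edgeSet := by
    ext e
    induction e with
    | _ a b =>
      simp only [mem_edgeSet, mem_iUnion]
      constructor
      · intro h
        have key : ∀ x y : Fin 3, ∃ k, x ≠ k ∧ y ≠ k := by decide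
        obtain ⟨k, hk⟩ := key (φ a) (φ b)
        exact ⟨k, h, hk⟩
      · rintro ⟨k, hk⟩
        exact hk.1
  rw [hU, Set.ncard_iUnion_of_finite (fun k => toFinite _), finsum_eq_sum_of_fintype]
  intro k l hkl
  rw [Function.onFun, Set.disjoint_left]
  intro e
  induction e with
  | _ a b =>
    intro h1 h2
    have key : ∀ x y k l : Fin 3, x ≠ y → k ≠ l → x ≠ k → y ≠ k → x ≠ l → y = l := by
      decide
    exact h2.2.2 (key _ _ _ _ (φ.valid h1.1) hkl h1.2.1 h1.2.2 h2.2.1)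

lemma sum_ncard_color_eq [Finite V] : ∑ k, {v | φ v = k}.ncard = Nat.card V := by
  have hU : (univ : Set V) = ⋃ k, {v | φ v = k} := by
    ext v; simp
  rw [← Set.ncard_univ, hU, Set.ncard_iUnion_of_finite (fun k => toFinite _),
    finsum_eq_sum_of_fintype]
  intro k l hkl
  rw [Function.onFun, Set.disjoint_left]
  rintro v rfl h
  exact hkl h

lemma avoidColor_eq_bot {k l : Fin 3} (hkl : k ≠ l) (h : avoidColor φ k = G) :
    avoidColor φ l = ⊥ := by
  ext a b
  simp only [bot_adj, iff_false]
  intro hab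
  have hk : (avoidColor φ k).Adj a b := by rw [h]; exact hab.1
  have key : ∀ x y k l : Fin 3, x ≠ y → k ≠ l → x ≠ k → y ≠ k → x ≠ l → y = l := by
    decide
  exact hab.2.2 (key _ _ _ _ (φ.valid hab.1) hkl hk.2.1 hk.2.2 hab.2.1)

end SimpleGraph

/-! ### Bichromatic faces and the final count -/

namespace PlaneDrawing

open SimpleGraph

variable {V : Type*} {G : SimpleGraph V} (D : PlaneDrawing G) (φ : G.Coloring (Fin 3))

/-- The bichromatic faces of length `4` without the color `k`. -/
def facesAvoiding (k : Fin 3) : Set (Set ℂ) :=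
  {F ∈ D.faces | (D.faceLength F = 4 ∧ D.Bichromatic φ F) ∧ ∀ v, D.VertexIncident v F → φ v ≠ k}

variable [Finite V]

lemma numBichromatic_le_sum : D.numBichromatic φ ≤ ∑ k, (D.facesAvoiding φ k).ncard := by
  have hfin : ∀ k, (D.facesAvoiding φ k).Finite := fun k => D.finite_faces.subset (sep_subset _ _)
  have hsub : {F ∈ D.faces | D.faceLength F = 4 ∧ D.Bichromatic φ F} ⊆
      ⋃ k, D.facesAvoiding φ k := by
    rintro F ⟨hF, hF4, hb⟩
    have hne : φ '' {v | D.VertexIncident v F} ≠ univ := by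
      intro h
      rw [Bichromatic, h, ncard_univ, Nat.card_eq_fintype_card, Fintype.card_fin] at hb
      omega
    obtain ⟨k, hk⟩ := (ne_univ_iff_exists_notMem _).mp hne
    exact mem_iUnion.mpr ⟨k, hF, ⟨hF4, hb⟩, fun v hv hvk => hk ⟨v, hv, hvk⟩⟩
  refine (ncard_le_ncard hsub (finite_iUnion hfin)).trans ?_
  exact ncard_iUnion_le_of_fintype _

/-- All edges incident with such a face avoid `k`, so none of its boundary is deleted. -/
lemma facesAvoiding_subset (k : Fin 3) :
    D.facesAvoiding φ k ⊆ (D.restrict (avoidColor_le φ k)).faces := by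
  rintro F ⟨hF, -, hk⟩
  refine mem_faces_restrict hF _ ?_
  rintro ⟨⟨a, b⟩, h⟩ he
  exact ⟨h, hk a (vertexIncident_of_edgeIncident he (Sym2.mem_mk_left a b)),
    hk b (vertexIncident_of_edgeIncident he (Sym2.mem_mk_right a b))⟩

/-- Either the bichromatic faces without the color `k` are few, or the graph is a two-colored tree
whose only face has length `4`. -/
lemma ncard_facesAvoiding_le (k : Fin 3) :
    (D.facesAvoiding φ k).ncard + 2 ≤ 2 * (D.restrict (avoidColor_le φ k)).faces.ncard ∨
      avoidColor φ k = G ∧ ∃ F, D.faces = {F} ∧ D.faceLength F = 4 := by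
  have hfin := (D.restrict (avoidColor_le φ k)).finite_faces
  have hle := ncard_le_ncard (D.facesAvoiding_subset φ k) hfin
  have hpos := (ncard_pos hfin).mpr (D.restrict (avoidColor_le φ k)).faces_nonempty
  -- There are at most as many such faces as faces of the subgraph, so failure forces the subgraph
  -- to have a single face, and that face is one of them.
  by_cases hlt : (D.facesAvoiding φ k).ncard + 2 ≤
      2 * (D.restrict (avoidColor_le φ k)).faces.ncard
  · exact Or.inl hlt
  · right
    obtain ⟨F, hF⟩ : (D.facesAvoiding φ k).Nonempty := by
      rw [← ncard_pos (hfin.subset (D.facesAvoiding_subset φ k))]; omega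
    have hone : (D.restrict (avoidColor_le φ k)).faces.ncard = 1 := by omega
    have hFH := D.facesAvoiding_subset φ k hF
    have hG := eq_of_mem_faces_restrict hF.1 (avoidColor_le φ k) hFH hone.le
    refine ⟨hG, F, ?_, hF.2.1.1⟩
    have h1 := (D.restrict (avoidColor_le φ k)).euler
    have h2 := D.euler
    rw [hone, hG] at h1
    obtain ⟨F', hF'⟩ := ncard_eq_one.mp (show D.faces.ncard = 1 by omega)
    have := hF' ▸ hF.1
    rw [hF', mem_singleton_iff.mp this]

lemma two_pow_le_card_coloring_pow (hconn : G.Connected) (htri : G.CliqueFree 3)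
    (hn : 3 ≤ Nat.card V) :
    2 ^ (D.sPlus + 8 + D.numBichromatic φ) ≤ Nat.card (G.Coloring (Fin 3)) ^ 6 := by
  set N := Nat.card (G.Coloring (Fin 3))
  have hkempe := two_pow_card_connectedComponent_le φ
  have hcol := sum_ncard_color_eq φ
  rw [Fin.sum_univ_three] at hcol
  by_cases htree : ∃ k, avoidColor φ k = G ∧ ∃ F, D.faces = {F} ∧ D.faceLength F = 4
  · obtain ⟨k, hk, F, hF, hF4⟩ := htree
    have hs : D.sPlus = 0 := by
      rw [sPlus_eq_sum]
      refine Finset.sum_eq_zero fun F' hF' => ?_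
      rw [Finite.mem_toFinset, hF, mem_singleton_iff] at hF'
      rw [hF', hF4, Nat.sub_self]
    have hq : D.numBichromatic φ ≤ 1 := by
      rw [← ncard_singleton F, ← hF]
      exact ncard_le_ncard (sep_subset _ _) D.finite_faces
    -- No edge meets color `k`, so no edge avoids either other color and each vertex is its own
    -- component. The two other colors together give `N ^ 2 ≥ 2 ^ n ≥ 8`.
    have hpow : ∀ l, k ≠ l → 2 ^ Nat.card V ≤ N * 2 ^ {v | φ v = l}.ncard := by
      intro l hkl
      have := hkempe l
      rwa [avoidColor_eq_bot φ hkl hk, card_connectedComponent_bot] at this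
    obtain ⟨i, j, hi, hj, hij⟩ : ∃ i j, k ≠ i ∧ k ≠ j ∧
        {v | φ v = i}.ncard + {v | φ v = j}.ncard ≤ Nat.card V := by
      fin_cases k
      · exact ⟨1, 2, by decide, by decide, by omega⟩
      · exact ⟨0, 2, by decide, by decide, by omega⟩
      · exact ⟨0, 1, by decide, by decide, by omega⟩
    have h1 : 2 ^ Nat.card V * 2 ^ Nat.card V ≤ N ^ 2 * 2 ^ Nat.card V := calc
      2 ^ Nat.card V * 2 ^ Nat.card V ≤
          (N * 2 ^ {v | φ v = i}.ncard) * (N * 2 ^ {v | φ v = j}.ncard) :=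
        Nat.mul_le_mul (hpow i hi) (hpow j hj)
      _ = N ^ 2 * 2 ^ ({v | φ v = i}.ncard + {v | φ v = j}.ncard) := by rw [pow_add]; ring
      _ ≤ N ^ 2 * 2 ^ Nat.card V := by gcongr; norm_num
    have h2 : 2 ^ 3 ≤ N ^ 2 :=
      (Nat.pow_le_pow_right (by norm_num) hn).trans (Nat.le_of_mul_le_mul_right h1 (by positivity))
    -- The single face has length 4, so `s⁺ = 0` and `q ≤ 1`.
    calc 2 ^ (D.sPlus + 8 + D.numBichromatic φ) ≤ 2 ^ 9 :=
          Nat.pow_le_pow_right (by norm_num) (by omega)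
      _ = (2 ^ 3) ^ 3 := by norm_num
      _ ≤ (N ^ 2) ^ 3 := Nat.pow_le_pow_left h2 3
      _ = N ^ 6 := by ring
  · push Not at htree
    have hfew := fun k => (D.ncard_facesAvoiding_le φ k).resolve_right
      fun h => by obtain ⟨h1, F, h2, h3⟩ := h; exact htree k h1 F h2 h3
    have heul := fun k => (D.restrict (avoidColor_le φ k)).euler
    have hq := D.numBichromatic_le_sum φ
    have hE := sum_ncard_edgeSet_avoidColor φ
    have hs := sPlus_add_eight (D := D) hconn htri hn
    rw [Fin.sum_univ_three] at hq hE
    -- Twice the sum of the three Euler formulas, with `2 (f_k - 1)` bounded below by the number of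
    -- bichromatic faces without `k` and `4n - 2e` replaced by `s⁺ + 8`.
    have hexp : D.sPlus + 8 + D.numBichromatic φ + 2 * Nat.card V ≤
        2 * (Nat.card (avoidColor φ 0).ConnectedComponent +
          Nat.card (avoidColor φ 1).ConnectedComponent +
          Nat.card (avoidColor φ 2).ConnectedComponent) := by
      have := heul 0
      have := heul 1
      have := heul 2
      have := hfew 0
      have := hfew 1
      have := hfew 2
      omega
    have hprod : 2 ^ (Nat.card (avoidColor φ 0).ConnectedComponent +
          Nat.card (avoidColor φ 1).ConnectedComponent +
          Nat.card (avoidColor φ 2).ConnectedComponent) ≤ N ^ 3 * 2 ^ Nat.card V := calc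
      _ = 2 ^ Nat.card (avoidColor φ 0).ConnectedComponent *
          2 ^ Nat.card (avoidColor φ 1).ConnectedComponent *
          2 ^ Nat.card (avoidColor φ 2).ConnectedComponent := by rw [pow_add, pow_add]
      _ ≤ (N * 2 ^ {v | φ v = 0}.ncard) * (N * 2 ^ {v | φ v = 1}.ncard) *
          (N * 2 ^ {v | φ v = 2}.ncard) :=
        Nat.mul_le_mul (Nat.mul_le_mul (hkempe 0) (hkempe 1)) (hkempe 2)
      _ = N ^ 3 * 2 ^ Nat.card V := by rw [← hcol, pow_add, pow_add]; ring
    -- The factor `4 ^ n` clears the denominators `2 ^ n_k` of the Kempe bounds, squared.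
    refine Nat.le_of_mul_le_mul_right (c := 2 ^ (2 * Nat.card V)) ?_ (by positivity)
    calc 2 ^ (D.sPlus + 8 + D.numBichromatic φ) * 2 ^ (2 * Nat.card V)
        = 2 ^ (D.sPlus + 8 + D.numBichromatic φ + 2 * Nat.card V) :=
        (pow_add _ _ _).symm
      _ ≤ 2 ^ (2 * (Nat.card (avoidColor φ 0).ConnectedComponent +
          Nat.card (avoidColor φ 1).ConnectedComponent +
          Nat.card (avoidColor φ 2).ConnectedComponent)) :=
        Nat.pow_le_pow_right (by norm_num) hexp
      _ = (2 ^ (Nat.card (avoidColor φ 0).ConnectedComponent +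
          Nat.card (avoidColor φ 1).ConnectedComponent +
          Nat.card (avoidColor φ 2).ConnectedComponent)) ^ 2 := by rw [mul_comm, pow_mul]
      _ ≤ (N ^ 3 * 2 ^ Nat.card V) ^ 2 := Nat.pow_le_pow_left hprod 2
      _ = N ^ 6 * 2 ^ (2 * Nat.card V) := by rw [mul_comm 2, pow_mul]; ring

end PlaneDrawing

theorem lemma3p2 {V : Type*} [Fintype V] (G : SimpleGraph V) (D : PlaneDrawing G)
    (hconn : G.Connected) (htri : G.CliqueFree 3) (hn : 3 ≤ Fintype.card V)
    (φ : G.Coloring (Fin 3)) :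
    (2 : ℝ) ^ (((D.sPlus : ℝ) + 8 + (D.numBichromatic φ : ℝ)) / 6) ≤
      (Nat.card (G.Coloring (Fin 3)) : ℝ) := by
  have h := D.two_pow_le_card_coloring_pow φ hconn htri (by rwa [Nat.card_eq_fintype_card])
  have h' : (2 : ℝ) ^ (D.sPlus + 8 + D.numBichromatic φ) ≤
      (Nat.card (G.Coloring (Fin 3)) : ℝ) ^ 6 := by exact_mod_cast h
  refine le_of_pow_le_pow_left₀ (n := 6) (by norm_num) (Nat.cast_nonneg _) (le_trans (le_of_eq ?_) h')
  rw [← Real.rpow_natCast, ← Real.rpow_mul (by norm_num), ← Real.rpow_natCast]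
  congr 1
  push_cast
  ring
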